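/- Let $\xi$ be the entire function with $\xi(s)=\pi^{-s/2}\,\Gamma(1+s/2)\,(s-1)\,\zeta(s)$. For complex $s$ and real $\beta\ge 0$ put $$n(s,\beta)=\sin(\pi s/4)\cdot 2\,\xi(2\beta+s),\qquad f(s,\beta)=\frac1{n(s,\beta)},$$ and for integers $w\ge 0$ and complex $z$ put $$P_{4w}(z,\beta)=\frac{(-1)^{w+1}}{\pi^{1-\beta}\,\Gamma(1+\beta)}\sum_{k\ge w+1}\frac{(-1)^k z^{2k}}{(1+\beta)_{2k}\,\bigl(2k+\beta-\tfrac12\bigr)\,\zeta(2\beta+4k)},$$ where $(x)_m=x(x+1)\cdots(x+m-1)$. For real $a<b$ let $V(a,b)=\{s\in\mathbb C: a<\operatorname{Re}s<b\}$, and let $V_{4w}=V(4w,4w+4)$ for every integer $w$. A function $j$ is an *analytic characteristic function* on $V(a,b)$ if it is analytic there and there is a nonzero positive measure $\mu$ on $\mathbb R$ such that $j(s)=\int_{\mathbb R}e^{sy}\,d\mu(y)$, absolutely convergent, for all $s\in V(a,b)$. A function $h$ is a *meromorphic characteristic function* on a set $D\subseteq\mathbb C$ if $h=1/j$ for an entire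 function $j$ such that: every zero of $j$ in $D$ lies on the real or the imaginary axis; if $0\in D$, then $j(0)=0$ and $j(it)=0$ for some real $t\ne0$ with $it\in D$; the real zeros of $j$ in $D$ are simple, and they are unbounded above (respectively below) if $D\cap\mathbb R$ is; and whenever $a<b$ are successive real zeros of $j$, both in $D$, with $V(a,b)\subseteq D$, the function $h$ or $-h$ is an analytic characteristic function on $V(a,b)$. **Lemma 6.2.** Let $\beta\ge 0$ be real. 1. For every integer $w\ge 0$ the series for $P_{4w}(z,\beta)$ converges absolutely for all $z\in\mathbb C$, $P_{4w}(v,\beta)$ is real for real $v$, $P_{4w}(0,\beta)=0$, and $P_{4w}(v,\beta)$ is strictly increasing in $v$ on $[0,\pi]$. 2. For every integer $w\ge 1$, $P_{4w}(v,\beta)>0$ for all $v>0$. 3. For every integer $w\ge1$, $f(s,\beta)$ is analytic on $V_{4w}$, and for $s\in V_{4w}$ $$(-1)^w f(s,\beta)=\int_{\mathbb R}e^{sy}\,P_{4w}(\pi e^{-2y},\beta)\,dy,$$ with absolute convergence; the density $P_{4w}(\pi e^{-2y},\beta)$ is positive for all real $y$. 4. $f(s,\beta)$ is a meromorphic characteristic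 function on $\{s:\operatorname{Re}s\ge 4\}$. 5. If $\beta=1/4$, then for every integer $w\ge1$ and all $s\in V(-4(w+1),-4w)$ $$(-1)^{w+1} f(s,\tfrac14)=\int_{\mathbb R}e^{sy}\,P_{4w}(\pi e^{2y},\tfrac14)\,dy,$$ with absolute convergence, and $f(s,\tfrac14)$ is a meromorphic characteristic function on $\{s:|\operatorname{Re}s|\ge 4\}$. -/

import Mathlib

noncomputable section

namespace ZetaLaplace

/-- The Riemann function `ξ`, i.e. the entire extension of
`(1/2) π^{-s/2} s Γ(s/2) (s - 1) ζ(s) = (1/2) s (s - 1) Λ(s)`. Since Mathlib's `Γ` and `ζ` take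
placeholder values at their poles, `ξ` is written with the entire part `Λ₀` of the completed zeta
function, `Λ(s) = Λ₀(s) - 1/s - 1/(1 - s)`. See `xi_eq` and `differentiable_xi`. -/
def xi (s : ℂ) : ℂ := (s * (s - 1) * completedRiemannZeta₀ s + 1) / 2

theorem differentiable_xi : Differentiable ℂ xi := by
  unfold xi
  have := differentiable_completedZeta₀
  fun_prop

/-- Away from the poles of `ζ` and `Γ(1 + s/2)`, `xi` is `(1/2) · π^{-s/2} 2Γ(1 + s/2) (s-1) ζ(s)`. -/
theorem xi_eq (s : ℂ) (h1 : s ≠ 1) (hs : ∀ k : ℕ, s ≠ -2 * ((k : ℂ) + 1)) :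
    xi s = 1 / 2 * ((Real.pi : ℂ) ^ (-s / 2) * (2 * Complex.Gamma (1 + s / 2)) * (s - 1))
      * riemannZeta s := by
  by_cases h0 : s = 0
  · subst h0
    simp [xi, riemannZeta_zero]
    norm_num
  · have hG : Complex.Gamma (s / 2) ≠ 0 := by
      refine Complex.Gamma_ne_zero fun m hm => ?_
      have hm' : s = -2 * (m : ℂ) := by linear_combination 2 * hm
      cases m with
      | zero => exact h0 (by simpa using hm')
      | succ k => exact hs k (by simpa using hm')
    have hpi : (Real.pi : ℂ) ^ (-s / 2) ≠ 0 := by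
      simp [Complex.cpow_eq_zero_iff, Real.pi_ne_zero]
    have h1' : (1 : ℂ) - s ≠ 0 := sub_ne_zero.mpr (Ne.symm h1)
    rw [riemannZeta_def_of_ne_zero h0, completedRiemannZeta_eq, Complex.Gammaℝ_def, add_comm 1,
      Complex.Gamma_add_one _ (div_ne_zero h0 two_ne_zero), xi]
    field_simp
    ring

/-- `n(s, β) = sin(π s / 4) · 2 ξ(2β + s)`. -/
def n (s β : ℂ) : ℂ := Complex.sin (Real.pi * s / 4) * (2 * xi (2 * β + s))

/-- `f(s, β) = 1 / n(s, β)`. -/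
def f (s β : ℂ) : ℂ := 1 / n s β

/-- The `k`-th term `(-1)^k z^{2k} / ((1+β)_{2k} (2k + β - 1/2) ζ(2β + 4k))` of the series
for `P_{4w}(z, β)`. -/
def PTerm (z β : ℂ) (k : ℕ) : ℂ :=
  (-1) ^ k * z ^ (2 * k) /
    ((ascPochhammer ℂ (2 * k)).eval (1 + β) * (2 * (k : ℂ) + β - 1 / 2)
      * riemannZeta (2 * β + 4 * (k : ℂ)))

/-- `P_{4w}(z, β)`; the sum runs over `k = w + 1 + j ≥ w + 1`. -/
def P (w : ℕ) (z β : ℂ) : ℂ :=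
  (-1) ^ (w + 1) / ((Real.pi : ℂ) ^ (1 - β) * Complex.Gamma (1 + β))
    * ∑' j : ℕ, PTerm z β (w + 1 + j)

/-- The open vertical strip `V(a, b)`. -/
def V (a b : ℝ) : Set ℂ := {s | a < s.re ∧ s.re < b}

/-- `j` is an analytic characteristic function on `V(a, b)`: it is analytic there and is the
absolutely convergent two-sided Laplace transform of a nonzero positive measure on the line. -/
def IsAnalyticCharFun (j : ℂ → ℂ) (a b : ℝ) : Prop :=
  DifferentiableOn ℂ j (V a b) ∧
    ∃ μ : MeasureTheory.Measure ℝ, μ ≠ 0 ∧ ∀ s ∈ V a b,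
      MeasureTheory.Integrable (fun y : ℝ => Complex.exp (s * y)) μ ∧
        j s = ∫ y : ℝ, Complex.exp (s * y) ∂μ

/-- `h` is a meromorphic characteristic function on the domain `D`. For `D = ℂ` this is the notion
of a meromorphic characteristic function on the plane; for a smaller `D`, each condition is
imposed on the part of the plane that lies in `D`. -/
def IsMeromorphicCharFunOn (h : ℂ → ℂ) (D : Set ℂ) : Prop :=
  ∃ j : ℂ → ℂ,
    -- `h` is the reciprocal of an entire function `j`
    Differentiable ℂ j ∧ (∀ z, h z = 1 / j z) ∧
    -- the zeros of `j` in `D` are real or purely imaginary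
    (∀ z ∈ D, j z = 0 → z.im = 0 ∨ z.re = 0) ∧
    -- if `0 ∈ D`, then `j` vanishes at `0` and at some other point of the imaginary axis
    ((0 : ℂ) ∈ D → j 0 = 0 ∧ ∃ t : ℝ, t ≠ 0 ∧ Complex.I * t ∈ D ∧ j (Complex.I * t) = 0) ∧
    -- the real zeros in `D` are unbounded above (below) when the real points of `D` are
    (¬ BddAbove {x : ℝ | (x : ℂ) ∈ D} → ¬ BddAbove {x : ℝ | (x : ℂ) ∈ D ∧ j x = 0}) ∧
    (¬ BddBelow {x : ℝ | (x : ℂ) ∈ D} → ¬ BddBelow {x : ℝ | (x : ℂ) ∈ D ∧ j x = 0}) ∧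
    -- the real zeros in `D` are simple
    (∀ x : ℝ, (x : ℂ) ∈ D → j x = 0 → deriv j x ≠ 0) ∧
    -- on a strip in `D` between successive real zeros, `h` or `-h` is an analytic
    -- characteristic function
    (∀ a b : ℝ, a < b → (a : ℂ) ∈ D → (b : ℂ) ∈ D → V a b ⊆ D → j a = 0 → j b = 0 →
      (∀ x : ℝ, a < x → x < b → j x ≠ 0) →
      IsAnalyticCharFun h a b ∨ IsAnalyticCharFun (fun z => -h z) a b)

end ZetaLaplace

end

/-! The Laplace transform formula is an instance of Ramanujan's master theorem. An alternating
series with coefficients A(2k), k > w, should have Mellin transform ± (π/2) A(z) / sin(πz/2) at -z,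
on the strip 2w < Re z < 2w + 2. For P_{4w} the function A is, up to a constant, the product of
1/Γ(1+β+z), 1/(z+β-1/2) and 1/ζ(2β+2z). With z = s/2 and v = π e^{-2y} the Mellin transform becomes
the two-sided Laplace transform, and the gamma, zeta and sine factors assemble to 1/n(s, β).

The formula is built up from one explicit case, A(z) = 1/Γ(1+z), whose kernel is the Taylor
remainder of the cosine (`hasMellin_cosRem`). Replacing g by an average ∫ c(t) g(τ(t) v) dν(t) of
its dilates multiplies both the coefficients and the Mellin transform by the moments ∫ c τ^z dν
(`IsMasterKernel.scaleAvg`). A beta weight turns Γ(1+z) into Γ(1+β+z), a power weight produces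
1/(z+β-1/2), and the weights μ(n) n^{-2β} with factors n^{-2} produce 1/ζ(2β+2z).

Positivity is carried along by being star-shaped: g > 0 and g(lx) ≤ l g(x) for 0 ≤ l ≤ 1. The cosine
remainder has this property because it is convex and vanishes at 0, and averages with positive
weights keep it. The Möbius weights are signed, but g(v/n²) ≤ g(v)/n² and ∑_{n≥2} n^{-2} = π²/6 - 1
< 1, so the term n = 1 dominates (`IsStarShaped.moebius_pos`).

Monotonicity on [0, π] is independent of this, and also covers w = 0: consecutive terms of the
series are paired, and each pair is increasing there (`strictMonoOn_pair`).

For Re s > 1 the factor ξ(2β+s) has no zero, so the zeros of n(s, β) are those of sin(πs/4), namely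
the simple zeros 4m. For β = 1/4 the functional equation makes n odd in s, which reflects everything
to the left half-plane. -/

open MeasureTheory Set Complex

/-! ### Averages of dilates: Mellin transforms, power series, star-shapedness. -/

/-- The weighted average `v ↦ ∫ c(t) g(τ(t) v) dν(t)` of the dilates of `g`. -/
noncomputable def scaleAvg {T : Type*} [MeasurableSpace T] (ν : Measure T) (c τ : T → ℝ)
    (g : ℝ → ℝ) (v : ℝ) : ℝ :=
  ∫ t, c t * g (τ t * v) ∂ν

section ScaleAvg

variable {T : Type*} [MeasurableSpace T] {ν : Measure T} {c τ : T → ℝ} {g : ℝ → ℝ}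

theorem measurable_scaleAvg [SFinite ν] (hc : Measurable c) (hτ : Measurable τ)
    (hg : Measurable g) : Measurable (scaleAvg ν c τ g) := by
  have : StronglyMeasurable (fun p : ℝ × T => c p.2 * g (τ p.2 * p.1)) :=
    Measurable.stronglyMeasurable (by fun_prop)
  exact this.integral_prod_right.measurable

/-- This is the scaling rule of the Mellin transform for |g| at the real point Re s. It supplies the
absolute integrability needed for Fubini in `hasMellin_scaleAvg`. -/
theorem integral_norm_mellin_comp_mul_left (s : ℂ) {a : ℝ} (ha : 0 < a) :
    ∫ v in Ioi (0 : ℝ), ‖(v : ℂ) ^ (s - 1) * (g (a * v) : ℂ)‖ =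
      a ^ (-s.re) * ∫ v in Ioi (0 : ℝ), ‖(v : ℂ) ^ (s - 1) * (g v : ℂ)‖ := by
  have key : ∀ h : ℝ → ℝ, ((∫ v in Ioi (0 : ℝ), ‖(v : ℂ) ^ (s - 1) * (h v : ℂ)‖ : ℝ) : ℂ) =
      mellin (fun v => ((|h v| : ℝ) : ℂ)) (s.re : ℂ) := by
    intro h
    rw [mellin, ← integral_complex_ofReal]
    refine setIntegral_congr_fun measurableSet_Ioi fun v hv => ?_
    have hv' : (0 : ℝ) < v := hv
    simp only [norm_mul, norm_cpow_eq_rpow_re_of_pos hv', smul_eq_mul, Complex.norm_real,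
      Real.norm_eq_abs, ofReal_mul, sub_re, one_re]
    rw [ofReal_cpow hv'.le]
    simp
  have h := mellin_comp_mul_left (fun v => ((|g v| : ℝ) : ℂ)) (s.re : ℂ) ha
  rw [← key (fun v => g (a * v)), ← key, smul_eq_mul, ← ofReal_neg, ← ofReal_cpow ha.le] at h
  exact_mod_cast h

/-- The Mellin transform of a weighted average of dilates of `g` is the Mellin transform of `g`
times the corresponding moment of the weight. -/
theorem hasMellin_scaleAvg [SFinite ν] (hc : Measurable c) (hτ : Measurable τ)
    (hg : Measurable g) (hpos : ∀ᵐ t ∂ν, 0 < τ t) {s m : ℂ}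
    (hm : HasMellin (fun v => (g v : ℂ)) s m)
    (hint : Integrable (fun t => c t * τ t ^ (-s.re)) ν) :
    HasMellin (fun v => (scaleAvg ν c τ g v : ℂ)) s
      (m * ∫ t, (c t : ℂ) * (τ t : ℂ) ^ (-s) ∂ν) := by
  have hmeas : Measurable
      (fun p : T × ℝ => (c p.1 : ℂ) * ((p.2 : ℂ) ^ (s - 1) * (g (τ p.1 * p.2) : ℂ))) := by
    fun_prop
  have hF : Integrable (fun p : T × ℝ => (c p.1 : ℂ) * ((p.2 : ℂ) ^ (s - 1) *
      (g (τ p.1 * p.2) : ℂ))) (ν.prod (volume.restrict (Ioi 0))) := by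
    rw [integrable_prod_iff hmeas.aestronglyMeasurable]
    refine ⟨?_, ?_⟩
    · filter_upwards [hpos] with t ht
      exact Integrable.const_mul
        ((MellinConvergent.comp_mul_left (f := fun v => (g v : ℂ)) ht).2 hm.1) _
    · have : Integrable (fun t => ‖c t * τ t ^ (-s.re)‖ *
          ∫ v in Ioi (0 : ℝ), ‖(v : ℂ) ^ (s - 1) * (g v : ℂ)‖) ν := hint.norm.mul_const _
      refine this.congr ?_
      filter_upwards [hpos] with t ht
      simp_rw [norm_mul (c t : ℂ), integral_const_mul, integral_norm_mellin_comp_mul_left s ht,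
        norm_mul, Complex.norm_real, Real.norm_of_nonneg (Real.rpow_nonneg ht.le _)]
      ring
  have hswap : ∀ v : ℝ, ∫ t, (c t : ℂ) * ((v : ℂ) ^ (s - 1) * (g (τ t * v) : ℂ)) ∂ν =
      (v : ℂ) ^ (s - 1) * (scaleAvg ν c τ g v : ℂ) := by
    intro v
    rw [scaleAvg, ← integral_complex_ofReal, ← integral_const_mul]
    refine integral_congr_ae (.of_forall fun t => ?_)
    simp only [ofReal_mul]
    ring
  refine ⟨?_, ?_⟩
  · have := hF.integral_prod_right
    simp only [hswap] at this
    exact this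
  · have := integral_integral_swap (f := fun (t : T) (v : ℝ) =>
      (c t : ℂ) * ((v : ℂ) ^ (s - 1) * (g (τ t * v) : ℂ))) hF
    simp only [hswap, integral_const_mul] at this
    simp only [mellin, smul_eq_mul]
    rw [← this, ← integral_const_mul]
    refine integral_congr_ae ?_
    filter_upwards [hpos] with t ht
    have h := mellin_comp_mul_left (fun v => (g v : ℂ)) s ht
    rw [hm.2] at h
    simp only [mellin, smul_eq_mul] at h
    rw [h]
    ring

/-- Averaging dilates of a power series multiplies its coefficients by the moments. -/
theorem hasSum_scaleAvg (hc : Measurable c) (hτ : Measurable τ)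
    (hpos : ∀ᵐ t ∂ν, 0 < τ t ∧ τ t ≤ 1) (hint : Integrable (fun t => c t * τ t) ν)
    {a : ℕ → ℝ} {p : ℕ → ℕ} (hp : ∀ j, 1 ≤ p j) {v : ℝ} (hv : 0 ≤ v)
    (hs : ∀ x, 0 ≤ x → HasSum (fun j => a j * x ^ p j) (g x)) :
    HasSum (fun j => a j * (∫ t, c t * τ t ^ p j ∂ν) * v ^ p j) (scaleAvg ν c τ g v) := by
  -- Since 0 < τ ≤ 1 and every exponent is at least 1, the single integrable function c τ dominates
  -- all the moments, which justifies exchanging sum and integral.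
  have hle : ∀ j, ∀ᵐ t ∂ν, ‖c t * τ t ^ p j‖ ≤ ‖c t * τ t‖ := by
    intro j
    filter_upwards [hpos] with t ht
    rw [norm_mul, norm_mul, norm_pow, Real.norm_of_nonneg ht.1.le]
    gcongr
    exact pow_le_of_le_one ht.1.le ht.2 (by have := hp j; omega)
  have hi : ∀ j, Integrable (fun t => c t * τ t ^ p j) ν := fun j =>
    hint.mono (by fun_prop) (hle j)
  have hF : ∀ j t, c t * (a j * (τ t * v) ^ p j) = c t * τ t ^ p j * (a j * v ^ p j) := by
    intro j t; rw [mul_pow]; ring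
  have h := hasSum_integral_of_summable_integral_norm (μ := ν)
    (F := fun j t => c t * (a j * (τ t * v) ^ p j))
    (fun j => by simp_rw [hF]; exact (hi j).mul_const _) ?_
  · have e : scaleAvg ν c τ g v = ∫ t, ∑' j, c t * (a j * (τ t * v) ^ p j) ∂ν := by
      refine integral_congr_ae ?_
      filter_upwards [hpos] with t ht
      rw [tsum_mul_left, (hs _ (mul_nonneg ht.1.le hv)).tsum_eq]
    rw [e]
    refine h.congr_fun fun j => ?_
    simp_rw [hF, integral_mul_const]
    ring
  · refine Summable.of_nonneg_of_le (fun j => by positivity) (fun j => ?_)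
      ((hs v hv).summable.norm.mul_left (∫ t, ‖c t * τ t‖ ∂ν))
    simp_rw [hF, norm_mul _ (a j * v ^ p j), integral_mul_const]
    gcongr ?_ * _
    exact integral_mono_ae (hi j).norm hint.norm (hle j)

/-- Measurable functions that are positive on `(0, ∞)` and satisfy `g (l x) ≤ l g x` for
`0 ≤ l ≤ 1`. -/
structure IsStarShaped (g : ℝ → ℝ) : Prop where
  measurable : Measurable g
  pos : ∀ x, 0 < x → 0 < g x
  le_mul : ∀ l x, 0 ≤ l → l ≤ 1 → 0 ≤ x → g (l * x) ≤ l * g x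

/-- Star-shapedness with l = τ(t) gives the majorant |c(t)| τ(t) g(v). -/
theorem IsStarShaped.integrable (hg : IsStarShaped g) (hc : Measurable c) (hτ : Measurable τ)
    (hpos : ∀ᵐ t ∂ν, 0 < τ t ∧ τ t ≤ 1) (hint : Integrable (fun t => c t * τ t) ν)
    {v : ℝ} (hv : 0 < v) : Integrable (fun t => c t * g (τ t * v)) ν := by
  have := hg.measurable
  refine (hint.mul_const (g v)).mono (by fun_prop) ?_
  filter_upwards [hpos] with t ht
  rw [mul_assoc, norm_mul, norm_mul (c t)]
  gcongr
  rw [Real.norm_of_nonneg (hg.pos _ (mul_pos ht.1 hv)).le]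
  exact (hg.le_mul _ _ ht.1.le ht.2 hv.le).trans (le_abs_self _)

/-- The defining inequalities hold for each dilate of g, and integration against a positive weight
preserves them; ν ≠ 0 keeps the positivity strict. -/
theorem IsStarShaped.scaleAvg [SFinite ν] (hg : IsStarShaped g) (h0 : g 0 = 0)
    (hc : Measurable c) (hτ : Measurable τ)
    (hpos : ∀ᵐ t ∂ν, 0 < τ t ∧ τ t ≤ 1) (hcpos : ∀ᵐ t ∂ν, 0 < c t) (hν : ν ≠ 0)
    (hint : Integrable (fun t => c t * τ t) ν) : IsStarShaped (scaleAvg ν c τ g) where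
  measurable := measurable_scaleAvg hc hτ hg.measurable
  pos v hv := by
    refine (integral_pos_iff_support_of_nonneg_ae ?_ (hg.integrable hc hτ hpos hint hv)).2 ?_
    · filter_upwards [hpos, hcpos] with t ht hct
      exact (mul_pos hct (hg.pos _ (mul_pos ht.1 hv))).le
    · have : Function.support (fun t => c t * g (τ t * v)) =ᵐ[ν] (univ : Set T) := by
        rw [ae_eq_univ]
        refine ae_iff.1 ?_
        filter_upwards [hpos, hcpos] with t ht hct
        exact (mul_pos hct (hg.pos _ (mul_pos ht.1 hv))).ne'
      rw [measure_congr this]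
      exact (Measure.measure_univ_pos).2 hν
  le_mul l x hl hl1 hx := by
    rcases hl.eq_or_lt with rfl | hl
    · simp [_root_.scaleAvg, h0]
    rcases hx.eq_or_lt with rfl | hx
    · simp [_root_.scaleAvg, h0]
    unfold _root_.scaleAvg
    rw [← integral_const_mul]
    refine integral_mono_ae (hg.integrable hc hτ hpos hint (mul_pos hl hx))
      ((hg.integrable hc hτ hpos hint hx).const_mul _) ?_
    filter_upwards [hpos, hcpos] with t ht hct
    have := hg.le_mul l (τ t * x) hl.le hl1 (mul_pos ht.1 hx).le
    calc c t * g (τ t * (l * x)) = c t * g (l * (τ t * x)) := by congr 2; ring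
      _ ≤ c t * (l * g (τ t * x)) := by gcongr
      _ = l * (c t * g (τ t * x)) := by ring

end ScaleAvg

/-! ### Taylor remainders of the cosine: positivity and convexity. -/

open scoped Nat in
/-- The remainder `(-1)^{w+1} (cos v - ∑_{k ≤ w} (-1)^k v^{2k} / (2k)!)` of the cosine series. -/
noncomputable def cosRem : ℕ → ℝ → ℝ
  | 0, v => 1 - Real.cos v
  | w + 1, v => v ^ (2 * (w + 1)) / (2 * (w + 1))! - cosRem w v

open scoped Nat in
/-- The remainder `(-1)^w (sin v - ∑_{k < w} (-1)^k v^{2k+1} / (2k+1)!)` of the sine series. -/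
noncomputable def sinRem : ℕ → ℝ → ℝ
  | 0, v => Real.sin v
  | w + 1, v => v ^ (2 * w + 1) / (2 * w + 1)! - sinRem w v

theorem hasDerivAt_pow_div_factorial (n : ℕ) (v : ℝ) :
    HasDerivAt (fun v : ℝ => v ^ (n + 1) / (n + 1).factorial) (v ^ n / n.factorial) v := by
  have := (hasDerivAt_pow (n + 1) v).div_const ((n + 1).factorial : ℝ)
  convert! this using 1
  rw [Nat.factorial_succ]
  push_cast
  field_simp

theorem hasDerivAt_cosRem (w : ℕ) (v : ℝ) : HasDerivAt (cosRem w) (sinRem w v) v := by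
  induction w with
  | zero => simpa [cosRem, sinRem] using! (Real.hasDerivAt_cos v).const_sub 1
  | succ w ih => exact (hasDerivAt_pow_div_factorial (2 * w + 1) v).sub ih

theorem hasDerivAt_sinRem (w : ℕ) (v : ℝ) : HasDerivAt (sinRem (w + 1)) (cosRem w v) v := by
  induction w with
  | zero =>
    have := (hasDerivAt_pow_div_factorial 0 v).sub (Real.hasDerivAt_sin v)
    simpa [cosRem, sinRem] using! this
  | succ w ih => exact (hasDerivAt_pow_div_factorial (2 * w + 2) v).sub ih

theorem continuous_cosRem (w : ℕ) : Continuous (cosRem w) :=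
  continuous_iff_continuousAt.2 fun v => (hasDerivAt_cosRem w v).continuousAt

theorem continuous_sinRem (w : ℕ) : Continuous (sinRem (w + 1)) :=
  continuous_iff_continuousAt.2 fun v => (hasDerivAt_sinRem w v).continuousAt

@[simp] theorem cosRem_zero_right (w : ℕ) : cosRem w 0 = 0 := by
  induction w with
  | zero => simp [cosRem]
  | succ w ih => simp [cosRem, ih]

@[simp] theorem sinRem_zero_right (w : ℕ) : sinRem w 0 = 0 := by
  induction w with
  | zero => simp [sinRem]
  | succ w ih => simp [sinRem, ih]

/-- The second derivative of `cosRem (w + 2)` is `cosRem (w + 1)`, and value and slope vanish at 0,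
so positivity propagates by integrating twice. The index starts at 1 because 1 - cos v has positive
zeros. -/
theorem cosRem_pos (w : ℕ) {v : ℝ} (hv : 0 < v) : 0 < cosRem (w + 1) v := by
  induction w generalizing v with
  | zero =>
    have := Real.one_sub_sq_div_two_lt_cos hv.ne'
    simp only [cosRem]
    norm_num [Nat.factorial]
    linarith
  | succ w ih =>
    have h1 : StrictMonoOn (sinRem (w + 2)) (Ici 0) := by
      refine strictMonoOn_of_deriv_pos (convex_Ici 0) (continuous_sinRem _).continuousOn ?_
      intro x hx
      rw [(hasDerivAt_sinRem _ x).deriv]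
      exact ih (by simpa using hx)
    have h2 : StrictMonoOn (cosRem (w + 2)) (Ici 0) := by
      refine strictMonoOn_of_deriv_pos (convex_Ici 0) (continuous_cosRem _).continuousOn ?_
      intro x hx
      have hx : 0 < x := by simpa using hx
      rw [(hasDerivAt_cosRem _ x).deriv]
      simpa using h1 (by simp) (show x ∈ Ici 0 from hx.le) hx
    simpa using h2 (by simp) (show v ∈ Ici 0 from hv.le) hv

theorem cosRem_nonneg (w : ℕ) {v : ℝ} (hv : 0 ≤ v) : 0 ≤ cosRem w v := by
  cases w with
  | zero => simpa [cosRem] using Real.cos_le_one v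
  | succ w =>
    rcases hv.eq_or_lt with rfl | h
    · simp
    · exact (cosRem_pos w h).le

/-- The second derivative is `cosRem w`, which is nonnegative. -/
theorem convexOn_cosRem (w : ℕ) : ConvexOn ℝ (Ici 0) (cosRem (w + 1)) := by
  refine MonotoneOn.convexOn_of_deriv (convex_Ici 0) (continuous_cosRem _).continuousOn
    (fun x _ => (hasDerivAt_cosRem _ x).differentiableAt.differentiableWithinAt) ?_
  have : deriv (cosRem (w + 1)) = sinRem (w + 1) := funext fun x => (hasDerivAt_cosRem _ x).deriv
  rw [this, interior_Ici]
  refine monotoneOn_of_deriv_nonneg (convex_Ioi 0) (continuous_sinRem _).continuousOn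
    (fun x _ => (hasDerivAt_sinRem _ x).differentiableAt.differentiableWithinAt) ?_
  intro x hx
  rw [(hasDerivAt_sinRem _ x).deriv]
  exact cosRem_nonneg _ (le_of_lt (by simpa using hx))

theorem isStarShaped_cosRem (w : ℕ) : IsStarShaped (cosRem (w + 1)) where
  measurable := (continuous_cosRem _).measurable
  pos _ hx := cosRem_pos w hx
  le_mul l x hl hl1 hx := by
    have := (convexOn_cosRem w).2 (show (0 : ℝ) ∈ Ici 0 by simp) (show x ∈ Ici 0 from hx)
      (sub_nonneg.2 hl1) hl (by ring)
    simpa using this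

open scoped Nat in
theorem hasSum_cosRem (w : ℕ) (v : ℝ) :
    HasSum (fun j : ℕ => (-1) ^ j / ((2 * (w + 1 + j))! : ℝ) * v ^ (2 * (w + 1 + j)))
      (cosRem w v) := by
  induction w with
  | zero =>
    have h := ((hasSum_nat_add_iff' 1).2 (Real.hasSum_cos v)).neg
    simp only [cosRem]
    convert! h using 1
    · funext j
      rw [show 2 * (0 + 1 + j) = 2 * (j + 1) by ring, pow_succ]
      ring
    · simp
  | succ w ih =>
    have h := ((hasSum_nat_add_iff' 1).2 ih).neg
    simp only [cosRem]
    convert! h using 1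
    · funext j
      rw [show 2 * (w + 1 + 1 + j) = 2 * (w + 1 + (j + 1)) by ring, pow_succ]
      ring
    · simp
      ring

open scoped Nat in
theorem cosRem_le_pow (w : ℕ) {v : ℝ} (hv : 0 ≤ v) :
    cosRem (w + 1) v ≤ v ^ (2 * (w + 1)) / (2 * (w + 1))! := by
  have := cosRem_nonneg w hv
  simp only [cosRem]
  linarith

open scoped Nat in
theorem cosRem_le_pow_succ (w : ℕ) {v : ℝ} (hv : 0 ≤ v) :
    cosRem w v ≤ v ^ (2 * (w + 1)) / (2 * (w + 1))! := by
  have := cosRem_nonneg (w + 1) hv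
  simp only [cosRem] at this
  linarith

/-! ### The Mellin transform of the cosine remainder. -/

/-- The remainder is O(v^{2w+2}) at infinity and O(v^{2w+4}) at 0; these two orders are the edges of
the strip. -/
theorem mellinConvergent_cosRem (w : ℕ) {z : ℂ} (h1 : 2 * (w + 1) < z.re)
    (h2 : z.re < 2 * (w + 2)) : MellinConvergent (fun v => (cosRem (w + 1) v : ℂ)) (-z) := by
  have key : ∀ k : ℕ, (∀ v : ℝ, 0 ≤ v → cosRem (w + 1) v ≤ v ^ (2 * k) / (2 * k).factorial) →
      ∀ l : Filter ℝ, (∀ᶠ v in l, 0 < v) →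
      (fun v => (cosRem (w + 1) v : ℂ)) =O[l] fun v : ℝ => v ^ (-(-(2 * (k : ℝ)))) := by
    intro k hk l hl
    refine Asymptotics.IsBigO.of_bound 1 ?_
    filter_upwards [hl] with v hv
    have hp : 0 ≤ v ^ (2 * k) := by positivity
    rw [Complex.norm_real, Real.norm_of_nonneg (cosRem_nonneg _ hv.le), neg_neg, one_mul,
      show (2 * (k : ℝ)) = ((2 * k : ℕ) : ℝ) by push_cast; ring, Real.rpow_natCast,
      Real.norm_of_nonneg hp]
    refine (hk v hv.le).trans (div_le_self hp ?_)
    exact_mod_cast Nat.one_le_iff_ne_zero.2 (Nat.factorial_ne_zero _)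
  refine mellinConvergent_of_isBigO_rpow (a := -(2 * ((w + 1 : ℕ) : ℝ)))
    (b := -(2 * ((w + 2 : ℕ) : ℝ))) ?_ ?_ ?_ ?_ ?_
  · exact (Complex.continuous_ofReal.comp (continuous_cosRem _)).continuousOn.locallyIntegrableOn
      measurableSet_Ioi
  · exact key (w + 1) (fun v hv => cosRem_le_pow w hv) _ (Filter.eventually_gt_atTop 0)
  · simp; linarith
  · exact key (w + 2) (fun v hv => cosRem_le_pow_succ (w + 1) hv) _ self_mem_nhdsWithin
  · simp; linarith

theorem integrableOn_pow_mul_exp_neg (n : ℕ) {t : ℝ} (ht : 0 < t) :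
    IntegrableOn (fun v : ℝ => v ^ n * Real.exp (-(t * v))) (Ioi 0) := by
  have := integrableOn_rpow_mul_exp_neg_mul_rpow (p := 1) (s := n) (b := t)
    (by have : (0 : ℝ) ≤ n := by positivity
        linarith) one_pos ht
  simpa using this

/-- The Laplace transform of the remainder of the cosine series. -/
theorem laplace_cosRem (w : ℕ) {t : ℝ} (ht : 0 < t) :
    IntegrableOn (fun v => cosRem w v * Real.exp (-(t * v))) (Ioi 0) ∧
      ∫ v in Ioi (0 : ℝ), cosRem w v * Real.exp (-(t * v)) =
        t⁻¹ ^ (2 * w + 1) * (1 + t ^ 2)⁻¹ := by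
  have hpow : ∀ n : ℕ, ∫ v in Ioi (0 : ℝ), v ^ n / n.factorial * Real.exp (-(t * v)) =
      t⁻¹ ^ (n + 1) := by
    intro n
    have h := Real.integral_rpow_mul_exp_neg_mul_Ioi (a := n + 1) (r := t) (by positivity) ht
    rw [add_sub_cancel_right, Real.Gamma_nat_eq_factorial,
      show ((n : ℝ) + 1) = ((n + 1 : ℕ) : ℝ) by push_cast; ring, Real.rpow_natCast, one_div] at h
    simp_rw [Real.rpow_natCast] at h
    simp_rw [div_mul_eq_mul_div, integral_div, h]
    field_simp
  have hint : ∀ n : ℕ, IntegrableOn (fun v : ℝ => v ^ n / n.factorial * Real.exp (-(t * v)))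
      (Ioi 0) := by
    intro n
    simp_rw [div_mul_eq_mul_div]
    exact (integrableOn_pow_mul_exp_neg n ht).div_const _
  induction w with
  | zero =>
    -- The transform of cos is the real part of ∫ e^{(-t+i)v} dv.
    have ha : (-(t : ℂ) + I).re < 0 := by simpa using ht
    have hi := (integrableOn_exp_mul_complex_Ioi ha 0).re
    have he := integral_exp_mul_complex_Ioi ha 0
    have hre : ∀ v : ℝ, (cexp ((-(t : ℂ) + I) * v)).re = Real.cos v * Real.exp (-(t * v)) := by
      intro v
      simp [Complex.exp_re]
      ring
    have hcos : IntegrableOn (fun v => Real.cos v * Real.exp (-(t * v))) (Ioi 0) := by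
      simpa [hre] using! hi
    have hval : ∫ v in Ioi (0 : ℝ), Real.cos v * Real.exp (-(t * v)) = t / (1 + t ^ 2) := by
      have h := integral_re (integrableOn_exp_mul_complex_Ioi ha 0)
      simp only [RCLike.re_eq_complex_re, hre, he] at h
      rw [h]
      simp [Complex.div_re, Complex.normSq_apply]
      field_simp
      ring
    have h0 := hint 0
    have e0 := hpow 0
    simp only [pow_zero, Nat.factorial_zero, Nat.cast_one, div_one, one_mul] at h0 e0
    simp only [cosRem, sub_mul, one_mul]
    refine ⟨h0.sub hcos, ?_⟩
    rw [integral_sub h0 hcos, hval, e0, inv_pow]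
    field_simp
    ring
  | succ w ih =>
    simp only [cosRem, sub_mul]
    refine ⟨(hint _).sub ih.1, ?_⟩
    rw [integral_sub (hint _) ih.1, ih.2, hpow, inv_pow, inv_pow]
    field_simp
    ring

theorem hasMellin_exp_neg {s : ℂ} (hs : 0 < s.re) :
    HasMellin (fun v : ℝ => ((Real.exp (-v) : ℝ) : ℂ)) s (Gamma s) := by
  refine ⟨?_, ?_⟩
  · have := GammaIntegral_convergent hs
    refine this.congr_fun (fun v _ => ?_) measurableSet_Ioi
    simp [mul_comm]
  · rw [Gamma_eq_integral hs, GammaIntegral_eq_mellin]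

/-- Writing 1/(1+v) as ∫ e^{-t} e^{-tv} dt makes it an average of dilates of e^{-v}. Its Mellin
transform is then Γ(s) Γ(1-s), and the reflection formula applies. -/
theorem hasMellin_inv_one_add {s : ℂ} (h0 : 0 < s.re) (h1 : s.re < 1) :
    HasMellin (fun v : ℝ => (((1 + v)⁻¹ : ℝ) : ℂ)) s (Real.pi / sin (Real.pi * s)) := by
  have key := hasMellin_scaleAvg (ν := volume.restrict (Ioi (0 : ℝ)))
    (c := fun t => Real.exp (-t)) (τ := fun t => t) (g := fun v => Real.exp (-v))
    (by fun_prop) (by fun_prop) (by fun_prop)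
    (by filter_upwards [self_mem_ae_restrict measurableSet_Ioi] with t ht using ht)
    (hasMellin_exp_neg h0) ?_
  · have e : (∫ t in Ioi (0 : ℝ), ((Real.exp (-t) : ℝ) : ℂ) * (t : ℂ) ^ (-s)) = Gamma (1 - s) := by
      rw [Gamma_eq_integral (by simpa using h1), GammaIntegral]
      refine setIntegral_congr_fun measurableSet_Ioi fun t _ => ?_
      simp [sub_eq_add_neg]
    rw [e, Gamma_mul_Gamma_one_sub] at key
    have hv : ∀ v ∈ Ioi (0 : ℝ), (((1 + v)⁻¹ : ℝ) : ℂ) = ((scaleAvg (volume.restrict (Ioi (0 : ℝ)))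
        (fun t => Real.exp (-t)) (fun t => t) (fun v => Real.exp (-v)) v : ℝ) : ℂ) := by
      intro v hv
      have hv : 0 < v := hv
      congr 1
      have : ∀ t : ℝ, Real.exp (-t) * Real.exp (-(t * v)) = Real.exp (-(1 + v) * t) := by
        intro t; rw [← Real.exp_add]; ring_nf
      simp_rw [scaleAvg, this]
      rw [integral_exp_mul_Ioi (by linarith)]
      rw [mul_zero, Real.exp_zero, neg_div_neg_eq, one_div]
    refine ⟨key.1.congr_fun (fun v hv' => ?_) measurableSet_Ioi, ?_⟩
    · simp only [hv v hv']
    · rw [← key.2]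
      refine setIntegral_congr_fun measurableSet_Ioi fun v hv' => ?_
      simp only [hv v hv']
  · have := Real.GammaIntegral_convergent (s := 1 - s.re) (by linarith)
    simpa [sub_eq_add_neg] using! this

theorem hasMellin_inv_one_add_sq {s : ℂ} (h0 : 0 < s.re) (h1 : s.re < 2) :
    HasMellin (fun v : ℝ => (((1 + v ^ 2)⁻¹ : ℝ) : ℂ)) s
      (Real.pi / 2 / sin (Real.pi * s / 2)) := by
  have h := hasMellin_inv_one_add (s := s / (2 : ℝ))
    (by simp only [div_ofReal_re]; linarith)
    (by simp only [div_ofReal_re]; linarith)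
  have hc := (MellinConvergent.comp_rpow (f := fun v : ℝ => (((1 + v)⁻¹ : ℝ) : ℂ)) (s := s)
    (a := 2) two_ne_zero).2 h.1
  have hm := mellin_comp_rpow (fun v : ℝ => (((1 + v)⁻¹ : ℝ) : ℂ)) s 2
  rw [h.2] at hm
  simp only [Real.rpow_two] at hc hm
  refine ⟨hc, hm.trans ?_⟩
  rw [abs_of_pos two_pos, Complex.real_smul]
  push_cast
  rw [mul_div_assoc (Real.pi : ℂ)]
  ring

/-- The Laplace transform of the remainder has a Mellin transform at 1 + z that can be found in two
ways. As an average of dilates of e^{-v} it is Γ(1+z) times the value sought; in closed form it is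
the Mellin transform of 1/(1+v²) at z - 2(w+1), which lies in the strip 0 < Re < 2. -/
theorem hasMellin_cosRem (w : ℕ) {z : ℂ} (h1 : 2 * (w + 1) < z.re) (h2 : z.re < 2 * (w + 2)) :
    HasMellin (fun v => (cosRem (w + 1) v : ℂ)) (-z)
      ((-1) ^ (w + 1) * (Real.pi / 2) / (Gamma (1 + z) * sin (Real.pi * z / 2))) := by
  have hz : 0 < (1 + z).re := by
    have : (0 : ℝ) ≤ w := by positivity
    simp; linarith
  have hconv := mellinConvergent_cosRem w h1 h2
  have key := hasMellin_scaleAvg (ν := volume.restrict (Ioi (0 : ℝ)))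
    (c := cosRem (w + 1)) (τ := fun t => t) (g := fun v => Real.exp (-v))
    (continuous_cosRem _).measurable (by fun_prop) (by fun_prop)
    (by filter_upwards [self_mem_ae_restrict measurableSet_Ioi] with t ht using ht)
    (hasMellin_exp_neg hz) ?_
  · refine ⟨hconv, ?_⟩
    have e : (∫ t in Ioi (0 : ℝ), (cosRem (w + 1) t : ℂ) * (t : ℂ) ^ (-(1 + z))) =
        mellin (fun v => (cosRem (w + 1) v : ℂ)) (-z) := by
      refine setIntegral_congr_fun measurableSet_Ioi fun t _ => ?_
      rw [smul_eq_mul, mul_comm, show -(1 + z) = -z - 1 by ring]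
    rw [e] at key
    have hL : mellin (fun v => (scaleAvg (volume.restrict (Ioi (0 : ℝ))) (cosRem (w + 1))
        (fun t => t) (fun v => Real.exp (-v)) v : ℂ)) (1 + z) =
        mellin (fun v : ℝ => (((1 + v ^ 2)⁻¹ : ℝ) : ℂ)) (z - 2 * (w + 1)) := by
      rw [show z - 2 * ((w : ℂ) + 1) = (1 + z) + (-(2 * (w + 1) + 1 : ℕ) : ℂ) by push_cast; ring,
        ← mellin_cpow_smul _ (1 + z)]
      refine setIntegral_congr_fun measurableSet_Ioi fun v hv => ?_
      have hv : 0 < v := hv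
      have hsc : scaleAvg (volume.restrict (Ioi (0 : ℝ))) (cosRem (w + 1))
          (fun t => t) (fun v => Real.exp (-v)) v =
          v⁻¹ ^ (2 * (w + 1) + 1) * (1 + v ^ 2)⁻¹ := by
        rw [← (laplace_cosRem (w + 1) hv).2]
        simp_rw [scaleAvg, mul_comm _ v]
      simp only [hsc, smul_eq_mul]
      rw [Complex.cpow_neg, Complex.cpow_natCast]
      push_cast
      rw [inv_pow]
    rw [key.2, (hasMellin_inv_one_add_sq (by simp; linarith) (by simp; linarith)).2] at hL
    have hs : sin (Real.pi * (z - 2 * (w + 1)) / 2) = (-1) ^ (w + 1) * sin (Real.pi * z / 2) := by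
      rw [show (Real.pi : ℂ) * (z - 2 * (w + 1)) / 2 =
        Real.pi * z / 2 - ((w + 1 : ℕ) : ℂ) * Real.pi by push_cast; ring]
      exact Complex.sin_antiperiodic.sub_nat_mul_eq _
    rw [hs] at hL
    have hG := Gamma_ne_zero_of_re_pos hz
    have h11 : ((-1 : ℂ) ^ (w + 1)) * (-1) ^ (w + 1) = 1 := by
      rw [← mul_pow]; simp
    rw [div_mul_eq_div_div_swap, eq_div_iff hG, mul_comm, hL]
    rw [div_mul_eq_div_div, div_eq_mul_inv _ ((-1 : ℂ) ^ (w + 1)),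
      ← eq_inv_of_mul_eq_one_left h11, mul_comm]
  · have : IntegrableOn _ (Ioi (0 : ℝ)) volume := hconv.norm
    refine this.congr_fun (fun t ht => ?_) measurableSet_Ioi
    have ht : 0 < t := ht
    beta_reduce
    rw [smul_eq_mul, norm_mul, norm_cpow_eq_rpow_re_of_pos ht, Complex.norm_real,
      Real.norm_of_nonneg (cosRem_nonneg _ ht.le), mul_comm]
    simp only [sub_re, neg_re, one_re, add_re]
    ring_nf

/-! ### Master-theorem kernels and the weights that act on them. -/

/-- `g` is, on `[0, ∞)`, the alternating power series with coefficients `A (2k)`, `k > w`, and its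
Mellin transform is the one given by Ramanujan's master theorem. -/
structure IsMasterKernel (w : ℕ) (A : ℂ → ℂ) (g : ℝ → ℝ) : Prop where
  measurable : Measurable g
  hasSum : ∀ v, 0 ≤ v → HasSum (fun j : ℕ =>
    (-1) ^ j * (A ((2 * (w + 1 + j) : ℕ) : ℂ)).re * v ^ (2 * (w + 1 + j))) (g v)
  hasMellin : ∀ z : ℂ, 2 * w < z.re → z.re < 2 * (w + 1) → HasMellin (fun v => (g v : ℂ)) (-z)
    ((-1) ^ w * (Real.pi / 2) / sin (Real.pi * z / 2) * A z)

theorem IsMasterKernel.congr {w : ℕ} (hw : 1 ≤ w) {A B : ℂ → ℂ} {g : ℝ → ℝ}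
    (h : IsMasterKernel w A g) (hAB : ∀ z : ℂ, 1 ≤ z.re → A z = B z) : IsMasterKernel w B g where
  measurable := h.measurable
  hasSum v hv := by
    convert h.hasSum v hv using 5 with j
    refine (hAB _ ?_).symm
    rw [natCast_re]
    exact_mod_cast (by omega : 1 ≤ 2 * (w + 1 + j))
  hasMellin z h1 h2 := by
    have hw' : (1 : ℝ) ≤ w := by exact_mod_cast hw
    rw [← hAB z (by linarith)]
    exact h.hasMellin z h1 h2

theorem IsMasterKernel.apply_zero {w : ℕ} {A : ℂ → ℂ} {g : ℝ → ℝ} (h : IsMasterKernel w A g) :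
    g 0 = 0 := by
  refine (h.hasSum 0 le_rfl).unique ?_
  convert! (hasSum_zero : HasSum (fun _ : ℕ => (0 : ℝ)) 0) using 1
  funext j
  rw [zero_pow (by omega), mul_zero]

/-- `c` and `τ ≤ 1` are a weight and a dilation factor with moments `∫ c τ^z dν = M z`. -/
structure HasMoments {T : Type*} [MeasurableSpace T] (ν : Measure T) (c τ : T → ℝ)
    (M : ℂ → ℂ) : Prop where
  measurable_weight : Measurable c
  measurable_factor : Measurable τ
  factor_mem : ∀ᵐ t ∂ν, 0 < τ t ∧ τ t ≤ 1
  integrable : ∀ x : ℝ, 1 ≤ x → Integrable (fun t => c t * τ t ^ x) ν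
  integral_eq : ∀ z : ℂ, 1 ≤ z.re → ∫ t, (c t : ℂ) * (τ t : ℂ) ^ z ∂ν = M z

section Moments

variable {T : Type*} [MeasurableSpace T] {ν : Measure T} {c τ : T → ℝ} {M : ℂ → ℂ}

theorem HasMoments.integrable_mul (h : HasMoments ν c τ M) :
    Integrable (fun t => c t * τ t) ν := by
  simpa using h.integrable 1 le_rfl

theorem HasMoments.natCast (h : HasMoments ν c τ M) {n : ℕ} (hn : 1 ≤ n) :
    M n = ((∫ t, c t * τ t ^ n ∂ν : ℝ) : ℂ) := by
  rw [← h.integral_eq n (by simpa using hn), ← integral_complex_ofReal]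
  simp

/-- The same function M enters at 2k in the coefficients and at z in the Mellin transform, so the
master-theorem relation survives. The hypothesis w ≥ 1 keeps Re z > 2w in the range Re z ≥ 1 where
the moments are known. -/
theorem IsMasterKernel.scaleAvg [SFinite ν] {w : ℕ} (hw : 1 ≤ w) {A : ℂ → ℂ} {g : ℝ → ℝ}
    (hg : IsMasterKernel w A g) (h : HasMoments ν c τ M) :
    IsMasterKernel w (fun z => A z * M z) (scaleAvg ν c τ g) where
  measurable := measurable_scaleAvg h.measurable_weight h.measurable_factor hg.measurable
  hasSum v hv := by
    have := hasSum_scaleAvg h.measurable_weight h.measurable_factor h.factor_mem h.integrable_mul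
      (fun j : ℕ => (by omega : 1 ≤ 2 * (w + 1 + j))) hv hg.hasSum
    convert this using 3 with j
    rw [h.natCast (by omega), re_mul_ofReal]
    ring
  hasMellin z h1 h2 := by
    have hw' : (1 : ℝ) ≤ w := by exact_mod_cast hw
    have := hasMellin_scaleAvg h.measurable_weight h.measurable_factor hg.measurable
      (h.factor_mem.mono fun t ht => ht.1) (hg.hasMellin z h1 h2)
      (by simpa using h.integrable z.re (by linarith))
    rwa [neg_neg, h.integral_eq z (by linarith), mul_assoc] at this

end Moments

theorem isMasterKernel_cosRem (w : ℕ) :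
    IsMasterKernel (w + 1) (fun z => (Gamma (1 + z))⁻¹) (cosRem (w + 1)) where
  measurable := (continuous_cosRem _).measurable
  hasSum v _ := by
    convert hasSum_cosRem (w + 1) v using 3 with j
    rw [add_comm 1, Gamma_nat_eq_factorial, ← ofReal_natCast, ← ofReal_inv, ofReal_re,
      div_eq_mul_inv]
  hasMellin z h1 h2 := by
    push_cast at h1 h2
    convert hasMellin_cosRem w h1 (by linarith) using 1
    rw [div_mul_eq_div_div_swap, div_eq_mul_inv _ (Gamma _), div_mul_eq_mul_div]

/-- The power weight on the unit interval. -/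
theorem hasMoments_rpow {β : ℝ} (hβ : 0 ≤ β) :
    HasMoments (volume.restrict (Ioo (0 : ℝ) 1)) (fun t => t ^ (β - 3 / 2)) (fun t => t)
      (fun z => (z + β - 1 / 2)⁻¹) where
  measurable_weight := by fun_prop
  measurable_factor := by fun_prop
  factor_mem := by
    filter_upwards [self_mem_ae_restrict measurableSet_Ioo] with t ht
    exact ⟨ht.1, ht.2.le⟩
  -- The exponent β - 3/2 + x exceeds -1 once x ≥ 1, although the weight alone need not be
  -- integrable at 0.
  integrable x hx := by
    have h : IntervalIntegrable (fun t : ℝ => t ^ (β - 3 / 2 + x)) volume 0 1 :=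
      intervalIntegral.intervalIntegrable_rpow' (by linarith)
    rw [intervalIntegrable_iff_integrableOn_Ioo_of_le zero_le_one] at h
    refine h.congr_fun (fun t ht => ?_) measurableSet_Ioo
    exact Real.rpow_add ht.1 _ _
  integral_eq z hz := by
    have hre : -1 < ((β - 3 / 2 : ℝ) + z : ℂ).re := by
      rw [add_re, ofReal_re]
      linarith
    have h := integral_cpow (a := 0) (b := 1) (Or.inl hre)
    have hne : ((β - 3 / 2 : ℝ) + z + 1 : ℂ) ≠ 0 := by
      intro h0
      have := congrArg re h0
      rw [add_re, one_re, zero_re] at this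
      linarith
    rw [intervalIntegral.integral_of_le zero_le_one, integral_Ioc_eq_integral_Ioo, ofReal_one,
      one_cpow, ofReal_zero, zero_cpow hne, sub_zero] at h
    rw [show z + β - 1 / 2 = ((β - 3 / 2 : ℝ) + z + 1 : ℂ) by push_cast; ring, ← one_div, ← h]
    refine setIntegral_congr_fun measurableSet_Ioo fun t ht => ?_
    have ht0 : (t : ℂ) ≠ 0 := ofReal_ne_zero.2 ht.1.ne'
    rw [cpow_add _ _ ht0, ofReal_cpow ht.1.le]

/-- The beta weight on the unit interval. -/
theorem hasMoments_beta {β : ℝ} (hβ : 0 < β) :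
    HasMoments (volume.restrict (Ioo (0 : ℝ) 1)) (fun t => (1 - t) ^ (β - 1) / Real.Gamma β)
      (fun t => t) (fun z => Gamma (1 + z) / Gamma (1 + β + z)) where
  measurable_weight := by fun_prop
  measurable_factor := by fun_prop
  factor_mem := by
    filter_upwards [self_mem_ae_restrict measurableSet_Ioo] with t ht
    exact ⟨ht.1, ht.2.le⟩
  integrable x hx := by
    have h := betaIntegral_convergent (u := ((x + 1 : ℝ) : ℂ)) (v := (β : ℂ))
      (by rw [ofReal_re]; linarith) (by simpa using hβ)
    rw [intervalIntegrable_iff_integrableOn_Ioo_of_le zero_le_one] at h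
    have h' : IntegrableOn _ (Ioo (0 : ℝ) 1) volume := h.norm.div_const (Real.Gamma β)
    refine h'.congr_fun (fun t ht => ?_) measurableSet_Ioo
    have h1 : 0 < 1 - t := sub_pos.2 ht.2
    simp only
    rw [norm_mul, norm_cpow_eq_rpow_re_of_pos ht.1, ← ofReal_one, ← ofReal_sub 1 t,
      norm_cpow_eq_rpow_re_of_pos h1]
    simp only [ofReal_add, ofReal_one, add_sub_cancel_right, ofReal_re, sub_re, one_re]
    ring
  integral_eq z hz := by
    have h := Gamma_mul_Gamma_eq_betaIntegral (s := 1 + z) (t := (β : ℂ))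
      (by rw [add_re, one_re]; linarith) (by simpa using hβ)
    have hG : Gamma (1 + β + z) ≠ 0 := by
      refine Gamma_ne_zero_of_re_pos ?_
      simp only [add_re, one_re, ofReal_re]
      linarith
    have hGb : Gamma (β : ℂ) ≠ 0 := Gamma_ne_zero_of_re_pos (by simpa using hβ)
    have e : (∫ t in Ioo (0 : ℝ) 1,
        (((1 - t) ^ (β - 1) / Real.Gamma β : ℝ) : ℂ) * (t : ℂ) ^ z) =
        betaIntegral (1 + z) β / Gamma β := by
      rw [betaIntegral, intervalIntegral.integral_of_le zero_le_one,
        integral_Ioc_eq_integral_Ioo, ← integral_div]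
      refine setIntegral_congr_fun measurableSet_Ioo fun t ht => ?_
      have h1 : 0 ≤ 1 - t := (sub_pos.2 ht.2).le
      rw [ofReal_div, ofReal_cpow h1, ← Gamma_ofReal, add_sub_cancel_left]
      push_cast
      ring
    rw [e, div_eq_div_iff hGb hG, mul_comm, h]
    congr 2
    ring

/-- A positive kernel with coefficients `1 / (Γ(1 + β + 2k) (2k + β - 1/2))`. -/
theorem exists_isMasterKernel {w : ℕ} (hw : 1 ≤ w) {β : ℝ} (hβ : 0 ≤ β) :
    ∃ g, IsStarShaped g ∧
      IsMasterKernel w (fun z => (Gamma (1 + β + z))⁻¹ * (z + β - 1 / 2)⁻¹) g := by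
  have hν : volume.restrict (Ioo (0 : ℝ) 1) ≠ 0 := by
    rw [Ne, Measure.restrict_eq_zero]
    simp
  have h1 : ∃ g, IsStarShaped g ∧ IsMasterKernel w (fun z => (Gamma (1 + β + z))⁻¹) g := by
    obtain ⟨w, rfl⟩ := Nat.exists_eq_add_of_le' hw
    -- The beta weight needs β > 0; for β = 0 the cosine remainder already has the required
    -- coefficients.
    rcases hβ.eq_or_lt with rfl | hβ
    · exact ⟨_, isStarShaped_cosRem w, by simpa using isMasterKernel_cosRem w⟩
    · have hM := hasMoments_beta hβ
      refine ⟨_, (isStarShaped_cosRem w).scaleAvg (by simp) hM.measurable_weight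
        hM.measurable_factor hM.factor_mem ?_ hν hM.integrable_mul,
        ((isMasterKernel_cosRem w).scaleAvg hw hM).congr hw ?_⟩
      · filter_upwards [self_mem_ae_restrict measurableSet_Ioo] with t ht
        exact div_pos (Real.rpow_pos_of_pos (sub_pos.2 ht.2) _) (Real.Gamma_pos_of_pos hβ)
      · intro z hz
        have : Gamma (1 + z) ≠ 0 := Gamma_ne_zero_of_re_pos (by rw [add_re, one_re]; linarith)
        field_simp
  obtain ⟨g, hs, hg⟩ := h1
  have hM := hasMoments_rpow hβ
  refine ⟨_, hs.scaleAvg hg.apply_zero hM.measurable_weight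
    hM.measurable_factor hM.factor_mem ?_ hν hM.integrable_mul, hg.scaleAvg hw hM⟩
  filter_upwards [self_mem_ae_restrict measurableSet_Ioo] with t ht
  exact Real.rpow_pos_of_pos ht.1 _

/-! ### Real coefficients, absolute convergence, monotonicity on [0, π]. -/

theorem riemannZeta_ofReal {x : ℝ} (hx : 1 < x) :
    riemannZeta x = ((∑' n : ℕ, 1 / (n : ℝ) ^ x : ℝ) : ℂ) := by
  rw [zeta_eq_tsum_one_div_nat_cpow (by simpa using hx), ofReal_tsum]
  refine tsum_congr fun n => ?_
  rw [ofReal_div, ofReal_cpow n.cast_nonneg]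
  simp

theorem ofReal_re_riemannZeta {x : ℝ} (hx : 1 < x) :
    ((riemannZeta x).re : ℂ) = riemannZeta x := by
  rw [riemannZeta_ofReal hx, ofReal_re]

theorem one_le_re_riemannZeta {x : ℝ} (hx : 1 < x) : 1 ≤ (riemannZeta x).re := by
  rw [riemannZeta_ofReal hx, ofReal_re]
  have h := (Real.summable_one_div_nat_rpow.2 hx).le_tsum 1 fun n _ => by positivity
  simpa using h

theorem re_riemannZeta_le {x : ℝ} (hx : 4 ≤ x) : (riemannZeta x).re ≤ Real.pi ^ 4 / 90 := by
  rw [riemannZeta_ofReal (by linarith), ofReal_re, ← hasSum_zeta_four.tsum_eq]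
  refine Summable.tsum_le_tsum (fun n => ?_) (Real.summable_one_div_nat_rpow.2 (by linarith))
    hasSum_zeta_four.summable
  rcases Nat.eq_zero_or_pos n with rfl | hn
  · simp [Real.zero_rpow (by linarith : x ≠ 0)]
  · have h1 : (1 : ℝ) ≤ n := by exact_mod_cast hn
    have : (n : ℝ) ^ 4 ≤ (n : ℝ) ^ x := by
      rw [← Real.rpow_natCast]
      exact Real.rpow_le_rpow_of_exponent_le h1 (by exact_mod_cast hx)
    gcongr

namespace ZetaLaplace

/-- The coefficient `1 / ((1+β)_{2k} (2k + β - 1/2) ζ(2β + 4k))`. -/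
noncomputable def coeff (β : ℝ) (k : ℕ) : ℝ :=
  1 / ((ascPochhammer ℝ (2 * k)).eval (1 + β) * (2 * k + β - 1 / 2)
    * (riemannZeta ((2 * β + 4 * k : ℝ) : ℂ)).re)

theorem ascPochhammer_eval_ofReal (β : ℝ) (n : ℕ) :
    (ascPochhammer ℂ n).eval (1 + β : ℂ) = (((ascPochhammer ℝ n).eval (1 + β) : ℝ) : ℂ) := by
  rw [← Complex.ofReal_one, ← Complex.ofReal_add, ← ascPochhammer_map Complex.ofRealHom]
  exact Polynomial.eval_map_apply Complex.ofRealHom _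

theorem factorial_le_ascPochhammer {β : ℝ} (hβ : 0 ≤ β) (n : ℕ) :
    (n.factorial : ℝ) ≤ (ascPochhammer ℝ n).eval (1 + β) := by
  induction n with
  | zero => simp
  | succ n ih =>
    rw [ascPochhammer_succ_eval, Nat.factorial_succ, mul_comm]
    push_cast
    exact mul_le_mul ih (by linarith) (by positivity) ((Nat.cast_nonneg _).trans ih)

section

variable {β : ℝ} {k : ℕ}

theorem ascPochhammer_pos (hβ : 0 ≤ β) (n : ℕ) : 0 < (ascPochhammer ℝ n).eval (1 + β) :=
  lt_of_lt_of_le (by positivity) (factorial_le_ascPochhammer hβ n)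

theorem four_le_arg (hβ : 0 ≤ β) (hk : 1 ≤ k) : 4 ≤ 2 * β + 4 * k := by
  have : (1 : ℝ) ≤ k := by exact_mod_cast hk
  linarith

theorem coeff_pos (hβ : 0 ≤ β) (hk : 1 ≤ k) : 0 < coeff β k := by
  have hk' : (1 : ℝ) ≤ k := by exact_mod_cast hk
  have h1 := ascPochhammer_pos hβ (2 * k)
  have h2 : 0 < 2 * k + β - 1 / 2 := by linarith
  have h3 := one_le_re_riemannZeta (x := 2 * β + 4 * k) (by linarith)
  unfold coeff
  positivity

theorem coeff_le (hβ : 0 ≤ β) (hk : 1 ≤ k) : coeff β k ≤ 1 / (2 * k).factorial := by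
  have hk' : (1 : ℝ) ≤ k := by exact_mod_cast hk
  have h1 := factorial_le_ascPochhammer hβ (2 * k)
  have h2 : 1 ≤ 2 * k + β - 1 / 2 := by linarith
  have h3 := one_le_re_riemannZeta (x := 2 * β + 4 * k) (by linarith)
  have h4 : (0 : ℝ) < (2 * k).factorial := by positivity
  unfold coeff
  refine one_div_le_one_div_of_le h4 ?_
  calc ((2 * k).factorial : ℝ) = (2 * k).factorial * 1 * 1 := by ring
    _ ≤ _ := by
      have h5 := h4.trans_le h1
      have h6 : 0 ≤ 2 * k + β - 1 / 2 := by linarith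
      gcongr

theorem PTerm_eq (hβ : 0 ≤ β) (hk : 1 ≤ k) (z : ℂ) :
    PTerm z β k = (-1) ^ k * z ^ (2 * k) * (coeff β k : ℂ) := by
  have hx : riemannZeta (2 * β + 4 * k) =
      (((riemannZeta ((2 * β + 4 * k : ℝ) : ℂ)).re : ℝ) : ℂ) := by
    rw [ofReal_re_riemannZeta (by linarith [four_le_arg hβ hk])]
    push_cast
    rfl
  rw [PTerm, hx, ascPochhammer_eval_ofReal, coeff]
  push_cast
  ring

/-- `P_{4w}(v, β)` as a real function. -/
noncomputable def realP (w : ℕ) (v β : ℝ) : ℝ :=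
  1 / (Real.pi ^ (1 - β) * Real.Gamma (1 + β)) *
    ∑' j : ℕ, (-1) ^ j * coeff β (w + 1 + j) * v ^ (2 * (w + 1 + j))

theorem P_ofReal (hβ : 0 ≤ β) (w : ℕ) (v : ℝ) : P w v β = (realP w v β : ℂ) := by
  have hs : ∀ j : ℕ, PTerm v β (w + 1 + j) = (-1) ^ (w + 1) *
      (((-1) ^ j * coeff β (w + 1 + j) * v ^ (2 * (w + 1 + j)) : ℝ) : ℂ) := by
    intro j
    rw [PTerm_eq hβ (by omega), pow_add (-1 : ℂ) (w + 1)]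
    push_cast
    ring
  have h11 : ((-1 : ℂ) ^ (w + 1)) * (-1) ^ (w + 1) = 1 := by
    rw [← mul_pow]; simp
  rw [P, realP, tsum_congr hs, tsum_mul_left, ← mul_assoc, div_mul_eq_mul_div, h11, ofReal_mul,
    ofReal_tsum, ofReal_div, ofReal_mul, ofReal_cpow Real.pi_nonneg, ← Gamma_ofReal]
  push_cast
  rfl

theorem summable_norm_PTerm (hβ : 0 ≤ β) (w : ℕ) (z : ℂ) :
    Summable fun j : ℕ => ‖PTerm z β (w + 1 + j)‖ := by
  have h := (Real.summable_pow_div_factorial ‖z‖).comp_injective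
    (i := fun j : ℕ => 2 * (w + 1 + j)) (fun a b h => by simpa using h)
  refine h.of_nonneg_of_le (fun j => norm_nonneg _) fun j => ?_
  rw [PTerm_eq hβ (by omega), norm_mul, norm_mul, norm_pow, norm_pow, norm_neg, norm_one, one_pow,
    one_mul, Complex.norm_real, Real.norm_of_nonneg (coeff_pos hβ (by omega)).le]
  have := coeff_le hβ (k := w + 1 + j) (by omega)
  rw [Function.comp_apply, div_eq_mul_one_div]
  gcongr

theorem summable_realP (hβ : 0 ≤ β) (w : ℕ) (v : ℝ) :
    Summable fun j : ℕ => (-1) ^ j * coeff β (w + 1 + j) * v ^ (2 * (w + 1 + j)) := by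
  refine Summable.of_norm ((summable_norm_PTerm hβ w v).congr fun j => ?_)
  rw [PTerm_eq hβ (by omega)]
  simp only [norm_mul, norm_pow, norm_neg, norm_one, one_pow, one_mul, Complex.norm_real]
  ring

/-- This is what makes the derivative of a pair of consecutive terms positive up to v = π. The
quotient of the zeta values is at most ζ(4) = π⁴/90, and the remaining factor is rational in k and
β. -/
theorem coeff_succ_mul_lt (hβ : 0 ≤ β) (hk : 1 ≤ k) :
    (k + 1) * coeff β (k + 1) * Real.pi ^ 2 < k * coeff β k := by
  have hk' : (1 : ℝ) ≤ k := by exact_mod_cast hk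
  have hpi := Real.pi_lt_d4
  have hpi0 := Real.pi_pos
  have hpi2 : Real.pi ^ 2 < 9.87 := by nlinarith
  have hz1 : (riemannZeta ((2 * β + 4 * k : ℝ) : ℂ)).re ≤ 1.09 := by
    have h := re_riemannZeta_le (four_le_arg hβ hk)
    have : Real.pi ^ 4 = Real.pi ^ 2 * Real.pi ^ 2 := by ring
    nlinarith
  have hz0 := one_le_re_riemannZeta (x := 2 * β + 4 * k) (by linarith)
  have hz2 := one_le_re_riemannZeta (x := 2 * β + 4 * (k + 1 : ℕ)) (by push_cast; linarith)
  have hp := ascPochhammer_pos hβ (2 * k)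
  have hps : (ascPochhammer ℝ (2 * (k + 1))).eval (1 + β) =
      (ascPochhammer ℝ (2 * k)).eval (1 + β) * (1 + β + 2 * k) * (2 + β + 2 * k) := by
    rw [show 2 * (k + 1) = 2 * k + 1 + 1 by ring, ascPochhammer_succ_eval,
      ascPochhammer_succ_eval]
    push_cast
    ring
  unfold coeff
  rw [hps]
  set Z1 := (riemannZeta ((2 * β + 4 * k : ℝ) : ℂ)).re
  set Z2 := (riemannZeta ((2 * β + 4 * (k + 1 : ℕ) : ℝ) : ℂ)).re
  set A := (ascPochhammer ℝ (2 * k)).eval (1 + β)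
  have h0 : 0 < 2 * k + β - 1 / 2 := by linarith
  -- The constant 11 is an upper bound for π² ζ(4). After substituting k = m + 1 the difference of
  -- the two sides has only nonnegative coefficients in m and β.
  have hpoly : 11 * (k + 1) * (2 * k + β - 1 / 2) ≤
      k * ((1 + β + 2 * k) * (2 + β + 2 * k) * (2 * (k + 1 : ℕ) + β - 1 / 2)) := by
    obtain ⟨m, hm, hkm⟩ : ∃ m : ℝ, 0 ≤ m ∧ (k : ℝ) = m + 1 := ⟨k - 1, by linarith, by ring⟩
    push_cast
    rw [hkm, ← sub_nonneg]
    ring_nf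
    positivity
  have hB : 0 < (1 + β + 2 * k) * (2 + β + 2 * k) * (2 * (k + 1 : ℕ) + β - 1 / 2) := by
    push_cast
    have : 0 < 2 * ((k : ℝ) + 1) + β - 1 / 2 := by linarith
    positivity
  rw [show (k + 1) * (1 / (A * (1 + β + 2 * k) * (2 + β + 2 * k) *
      (2 * (k + 1 : ℕ) + β - 1 / 2) * Z2)) * Real.pi ^ 2 =
      (k + 1) * Real.pi ^ 2 / (A * ((1 + β + 2 * k) * (2 + β + 2 * k) *
      (2 * (k + 1 : ℕ) + β - 1 / 2)) * Z2) by ring, mul_one_div, div_lt_div_iff₀ (by positivity)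
      (by positivity)]
  have hc : Real.pi ^ 2 * Z1 < 11 * Z2 := by nlinarith [sq_nonneg Real.pi]
  calc (k + 1) * Real.pi ^ 2 * (A * (2 * k + β - 1 / 2) * Z1)
      = A * ((k + 1) * (2 * k + β - 1 / 2)) * (Real.pi ^ 2 * Z1) := by ring
    _ < A * ((k + 1) * (2 * k + β - 1 / 2)) * (11 * Z2) := by gcongr
    _ = A * Z2 * (11 * (k + 1) * (2 * k + β - 1 / 2)) := by ring
    _ ≤ A * Z2 * (k * ((1 + β + 2 * k) * (2 + β + 2 * k) * (2 * (k + 1 : ℕ) + β - 1 / 2))) := by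
        gcongr
    _ = _ := by ring

theorem strictMonoOn_pair (hβ : 0 ≤ β) (hk : 1 ≤ k) :
    StrictMonoOn (fun v : ℝ => coeff β k * v ^ (2 * k) - coeff β (k + 1) * v ^ (2 * (k + 1)))
      (Icc 0 Real.pi) := by
  refine strictMonoOn_of_deriv_pos (convex_Icc _ _) (by fun_prop) fun x hx => ?_
  rw [interior_Icc] at hx
  have h1 : HasDerivAt
      (fun v : ℝ => coeff β k * v ^ (2 * k) - coeff β (k + 1) * v ^ (2 * (k + 1)))
      (coeff β k * ((2 * k : ℕ) * x ^ (2 * k - 1)) -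
        coeff β (k + 1) * ((2 * (k + 1) : ℕ) * x ^ (2 * (k + 1) - 1))) x :=
    ((hasDerivAt_pow _ x).const_mul _).sub ((hasDerivAt_pow _ x).const_mul _)
  rw [h1.deriv, show 2 * (k + 1) - 1 = (2 * k - 1) + 2 by omega, pow_add]
  have hc := coeff_succ_mul_lt hβ hk
  have hp := coeff_pos hβ (k := k + 1) (by omega)
  have hx2 : x ^ 2 ≤ Real.pi ^ 2 := pow_le_pow_left₀ hx.1.le hx.2.le 2
  have h2 : (k + 1) * coeff β (k + 1) * x ^ 2 ≤ (k + 1) * coeff β (k + 1) * Real.pi ^ 2 := by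
    gcongr
  have hxk : 0 < x ^ (2 * k - 1) := pow_pos hx.1 _
  have : 0 < 2 * x ^ (2 * k - 1) * (k * coeff β k - (k + 1) * coeff β (k + 1) * x ^ 2) :=
    mul_pos (by positivity) (by linarith)
  push_cast
  linarith

/-- Absolute convergence allows the alternating series to be regrouped into pairs of consecutive
terms, each strictly increasing on [0, π]. -/
theorem strictMonoOn_realP (hβ : 0 ≤ β) (w : ℕ) :
    StrictMonoOn (fun v => realP w v β) (Icc 0 Real.pi) := by
  have hsum : ∀ v, HasSum (fun i : ℕ => coeff β (w + 1 + 2 * i) * v ^ (2 * (w + 1 + 2 * i)) -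
      coeff β (w + 1 + 2 * i + 1) * v ^ (2 * (w + 1 + 2 * i + 1)))
      (∑' j : ℕ, (-1) ^ j * coeff β (w + 1 + j) * v ^ (2 * (w + 1 + j))) := by
    intro v
    have hs := summable_realP hβ w v
    generalize hF : (fun j : ℕ => (-1) ^ j * coeff β (w + 1 + j) * v ^ (2 * (w + 1 + j))) = F
    rw [hF] at hs
    have he : Summable fun i : ℕ => F (2 * i) :=
      hs.comp_injective (mul_right_injective₀ two_ne_zero)
    have ho : Summable fun i : ℕ => F (2 * i + 1) :=
      hs.comp_injective ((add_left_injective 1).comp (mul_right_injective₀ two_ne_zero))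
    rw [← tsum_even_add_odd he ho]
    refine (he.hasSum.add ho.hasSum).congr_fun fun i => ?_
    rw [← hF]
    simp only [pow_succ (-1 : ℝ) (2 * i), pow_mul (-1 : ℝ) 2 i, neg_one_sq, one_pow, add_assoc]
    ring
  intro x hx y hy hxy
  have hconst : 0 < 1 / (Real.pi ^ (1 - β) * Real.Gamma (1 + β)) := by
    have := Real.Gamma_pos_of_pos (by linarith : 0 < 1 + β)
    positivity
  refine mul_lt_mul_of_pos_left ?_ hconst
  exact hasSum_lt (fun i => (strictMonoOn_pair hβ (by omega) hx hy hxy).le)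
    (i := 0) (strictMonoOn_pair hβ (by omega) hx hy hxy) (hsum x) (hsum y)

theorem realP_zero (w : ℕ) : realP w 0 β = 0 := by
  simp [realP]

end

end ZetaLaplace

/-! ### The Möbius average, positivity for w ≥ 1, and the Mellin transform of P. -/

theorem hasSum_riemannZeta_inv {s : ℂ} (hs : 1 < s.re) :
    HasSum (fun n : ℕ => (ArithmeticFunction.moebius (n + 1) : ℂ) * ((n + 1 : ℕ) : ℂ) ^ (-s))
      (riemannZeta s)⁻¹ := by
  have h1 := ArithmeticFunction.LSeries_zeta_mul_Lseries_moebius hs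
  rw [ArithmeticFunction.LSeries_zeta_eq_riemannZeta hs] at h1
  have h2 := (ArithmeticFunction.LSeriesSummable_moebius_iff.2 hs).LSeriesHasSum
  rw [eq_inv_of_mul_eq_one_right h1] at h2
  have h3 := (hasSum_nat_add_iff' 1).2 h2
  simp only [Finset.range_one, Finset.sum_singleton, LSeries.term_zero, sub_zero] at h3
  refine h3.congr_fun fun n => ?_
  rw [LSeries.term_of_ne_zero (by omega), cpow_neg, div_eq_mul_inv]

theorem integral_count_eq_tsum {E : Type*} [NormedAddCommGroup E] [NormedSpace ℝ E]
    [CompleteSpace E] {f : ℕ → E} (hf : Summable fun n => ‖f n‖) :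
    ∫ n, f n ∂Measure.count = ∑' n, f n := by
  rw [integral_countable (integrable_count_iff.2 hf)]
  simp [Measure.real]

/-- The Möbius weight `μ(n) n^{-2β}` with dilation factor `n^{-2}`. -/
theorem hasMoments_moebius {β : ℝ} (hβ : 0 ≤ β) :
    HasMoments (Measure.count : Measure ℕ)
      (fun n => (ArithmeticFunction.moebius (n + 1) : ℝ) * ((n + 1 : ℕ) : ℝ) ^ (-2 * β))
      (fun n => (((n + 1 : ℕ) : ℝ) ^ 2)⁻¹) (fun z => (riemannZeta (2 * β + 2 * z))⁻¹) := by
  have hpos : ∀ n : ℕ, (0 : ℝ) < (n + 1 : ℕ) := fun n => by positivity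
  have hterm : ∀ (z : ℂ) (n : ℕ),
      (((ArithmeticFunction.moebius (n + 1) : ℝ) * ((n + 1 : ℕ) : ℝ) ^ (-2 * β) : ℝ) : ℂ) *
        (((((n + 1 : ℕ) : ℝ) ^ 2)⁻¹ : ℝ) : ℂ) ^ z =
      (ArithmeticFunction.moebius (n + 1) : ℂ) * ((n + 1 : ℕ) : ℂ) ^ (-(2 * β + 2 * z)) := by
    intro z n
    have h0 : ((n + 1 : ℕ) : ℂ) ≠ 0 := by exact_mod_cast (hpos n).ne'
    have e : ((((n + 1 : ℕ) : ℝ) ^ 2)⁻¹ : ℝ) = ((n + 1 : ℕ) : ℝ) ^ (-2 : ℝ) := by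
      rw [Real.rpow_neg (hpos n).le, Real.rpow_two]
    rw [e, ← cpow_mul_ofReal_nonneg (hpos n).le, ofReal_mul, ofReal_cpow (hpos n).le, neg_add,
      cpow_add _ _ h0]
    push_cast
    ring_nf
  have hsum : ∀ z : ℂ, 1 ≤ z.re → Summable fun n : ℕ =>
      ‖(((ArithmeticFunction.moebius (n + 1) : ℝ) * ((n + 1 : ℕ) : ℝ) ^ (-2 * β) : ℝ) : ℂ) *
        (((((n + 1 : ℕ) : ℝ) ^ 2)⁻¹ : ℝ) : ℂ) ^ z‖ := by
    intro z hz
    simp_rw [hterm]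
    exact (hasSum_riemannZeta_inv (s := 2 * β + 2 * z)
      (by simp; linarith)).summable.norm
  refine ⟨measurable_of_countable _, measurable_of_countable _, .of_forall fun n => ⟨?_, ?_⟩,
    fun x hx => integrable_count_iff.2 ?_, fun z hz => ?_⟩
  · have := hpos n
    positivity
  · refine inv_le_one_of_one_le₀ (one_le_pow₀ ?_)
    exact_mod_cast Nat.le_add_left 1 n
  · refine (hsum x (by simpa using hx)).congr fun n => ?_
    have := hpos n
    rw [← ofReal_cpow (by positivity), ← ofReal_mul, Complex.norm_real]
  · rw [integral_count_eq_tsum (hsum z hz), tsum_congr (hterm z)]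
    exact (hasSum_riemannZeta_inv (s := 2 * β + 2 * z) (by simp; linarith)).tsum_eq

/-- The Möbius sum `∑ μ(n) n^{-2β} g(v / n²)` is positive where `g` is positive and star-shaped,
because `∑_{n ≥ 2} n^{-2} < 1`. -/
theorem IsStarShaped.moebius_pos {g : ℝ → ℝ} (hg : IsStarShaped g) {β : ℝ} (hβ : 0 ≤ β)
    {v : ℝ} (hv : 0 < v) :
    0 < _root_.scaleAvg (Measure.count : Measure ℕ)
      (fun n => (ArithmeticFunction.moebius (n + 1) : ℝ) * ((n + 1 : ℕ) : ℝ) ^ (-2 * β))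
      (fun n => (((n + 1 : ℕ) : ℝ) ^ 2)⁻¹) g v := by
  have hM := hasMoments_moebius hβ
  have hint := hg.integrable hM.measurable_weight hM.measurable_factor hM.factor_mem
    hM.integrable_mul hv
  have hs := integrable_count_iff.1 hint
  have hz : HasSum (fun n : ℕ => (((n + 1 : ℕ) : ℝ) ^ 2)⁻¹) (Real.pi ^ 2 / 6) := by
    have h := (hasSum_nat_add_iff' 1).2 hasSum_zeta_two
    simpa using h
  have hz' := ((hasSum_nat_add_iff' 1).2 hz).mul_right (-g v)
  rw [_root_.scaleAvg, integral_count_eq_tsum hs, hs.of_norm.tsum_eq_zero_add]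
  -- The terms with n ≥ 2 are bounded by g(v)/n², since |μ(n)| ≤ 1 and n^{-2β} ≤ 1.
  have hle : (Real.pi ^ 2 / 6 - 1) * (-g v) ≤ ∑' n : ℕ,
      (ArithmeticFunction.moebius (n + 1 + 1) : ℝ) * ((n + 1 + 1 : ℕ) : ℝ) ^ (-2 * β) *
        g ((((n + 1 + 1 : ℕ) : ℝ) ^ 2)⁻¹ * v) := by
    refine hasSum_le (fun n => ?_) (by simpa using hz')
      ((summable_nat_add_iff 1).2 hs.of_norm).hasSum
    have h1 : (1 : ℝ) ≤ ((n + 1 + 1 : ℕ) : ℝ) := by exact_mod_cast Nat.le_add_left 1 (n + 1)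
    have hτ : (((n + 1 + 1 : ℕ) : ℝ) ^ 2)⁻¹ ≤ 1 := inv_le_one_of_one_le₀ (one_le_pow₀ h1)
    have h2 := hg.le_mul _ v (by positivity) hτ hv.le
    have h3 := hg.pos ((((n + 1 + 1 : ℕ) : ℝ) ^ 2)⁻¹ * v) (by positivity)
    have hmu : |(ArithmeticFunction.moebius (n + 1 + 1) : ℝ)| ≤ 1 := by
      exact_mod_cast ArithmeticFunction.abs_moebius_le_one
    have hp0 : 0 ≤ ((n + 1 + 1 : ℕ) : ℝ) ^ (-2 * β) := by positivity
    have hp1 : ((n + 1 + 1 : ℕ) : ℝ) ^ (-2 * β) ≤ 1 :=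
      Real.rpow_le_one_of_one_le_of_nonpos h1 (by linarith)
    have habs : |(ArithmeticFunction.moebius (n + 1 + 1) : ℝ) *
        ((n + 1 + 1 : ℕ) : ℝ) ^ (-2 * β) * g ((((n + 1 + 1 : ℕ) : ℝ) ^ 2)⁻¹ * v)| ≤
        (((n + 1 + 1 : ℕ) : ℝ) ^ 2)⁻¹ * g v := by
      rw [abs_mul, abs_mul, abs_of_nonneg hp0, abs_of_pos h3]
      calc _ ≤ 1 * 1 * g ((((n + 1 + 1 : ℕ) : ℝ) ^ 2)⁻¹ * v) := by gcongr
        _ ≤ _ := by simpa using h2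
    have := (abs_le.1 habs).1
    push_cast at this ⊢
    linarith
  have hgv := hg.pos v hv
  have hpi : Real.pi ^ 2 / 6 - 1 < 1 := by
    nlinarith [Real.pi_lt_d2, Real.pi_pos]
  have h0 : (ArithmeticFunction.moebius (0 + 1) : ℝ) * ((0 + 1 : ℕ) : ℝ) ^ (-2 * β) *
        g ((((0 + 1 : ℕ) : ℝ) ^ 2)⁻¹ * v) = g v := by
    simp
  rw [h0]
  nlinarith

namespace ZetaLaplace

variable {β : ℝ}

/-- For `w ≥ 1`, `P_{4w}` is on `[0, ∞)` a multiple of a positive master kernel. -/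
theorem realP_kernel (hβ : 0 ≤ β) {w : ℕ} (hw : 1 ≤ w) :
    ∃ g : ℝ → ℝ, (∀ v, 0 < v → 0 < g v) ∧
      (∀ v, 0 ≤ v → realP w v β = Real.pi ^ (β - 1) * g v) ∧
      IsMasterKernel w (fun z => (Gamma (1 + β + z))⁻¹ * (z + β - 1 / 2)⁻¹ *
        (riemannZeta (2 * β + 2 * z))⁻¹) g := by
  -- The Möbius average comes last: it consumes star-shapedness and, being signed, yields only
  -- positivity.
  obtain ⟨q, hq, hqk⟩ := exists_isMasterKernel hw hβ
  have hk := hqk.scaleAvg hw (hasMoments_moebius hβ)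
  refine ⟨_, fun v hv => hq.moebius_pos hβ hv, fun v hv => ?_, hk⟩
  rw [← (hk.hasSum v hv).tsum_eq, realP, one_div, mul_inv, ← Real.rpow_neg Real.pi_nonneg, neg_sub,
    mul_assoc, ← tsum_mul_left]
  congr 1
  refine tsum_congr fun j => ?_
  set k := w + 1 + j with hkdef
  have hG : Gamma (1 + β + ((2 * k : ℕ) : ℂ)) =
      ((Real.Gamma (1 + β) * (ascPochhammer ℝ (2 * k)).eval (1 + β) : ℝ) : ℂ) := by
    have h1 : Gamma (1 + β : ℂ) ≠ 0 :=
      Gamma_ne_zero_of_re_pos (by rw [add_re, one_re, ofReal_re]; linarith)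
    have h := Gamma_add_nat_div_Gamma_eq (n := 2 * k) (1 + β : ℂ) fun m hm => by
      have := congrArg re hm
      simp only [add_re, one_re, ofReal_re, neg_re, natCast_re] at this
      have : (0 : ℝ) ≤ m := m.cast_nonneg
      linarith
    rw [div_eq_iff h1, ascPochhammer_eval_ofReal] at h
    rw [h, ofReal_mul, ← Gamma_ofReal, mul_comm]
    push_cast
    rfl
  have hZ : riemannZeta (2 * β + 2 * ((2 * k : ℕ) : ℂ)) =
      (((riemannZeta ((2 * β + 4 * k : ℝ) : ℂ)).re : ℝ) : ℂ) := by
    rw [ofReal_re_riemannZeta (by linarith [four_le_arg hβ (k := k) (by omega)])]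
    push_cast
    ring_nf
  have hA : (Gamma (1 + β + ((2 * k : ℕ) : ℂ)))⁻¹ * (((2 * k : ℕ) : ℂ) + β - 1 / 2)⁻¹ *
      (riemannZeta (2 * β + 2 * ((2 * k : ℕ) : ℂ)))⁻¹ =
      (((Real.Gamma (1 + β))⁻¹ * coeff β k : ℝ) : ℂ) := by
    rw [hG, hZ, coeff]
    push_cast
    simp only [mul_inv, one_div]
    ring
  rw [hA, ofReal_re]
  ring

theorem realP_pos (hβ : 0 ≤ β) {w : ℕ} (hw : 1 ≤ w) {v : ℝ} (hv : 0 < v) : 0 < realP w v β := by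
  obtain ⟨g, h1, h2, -⟩ := realP_kernel hβ hw
  rw [h2 v hv.le]
  exact mul_pos (Real.rpow_pos_of_pos Real.pi_pos _) (h1 v hv)

theorem hasMellin_realP (hβ : 0 ≤ β) {w : ℕ} (hw : 1 ≤ w) {z : ℂ} (h1 : 2 * w < z.re)
    (h2 : z.re < 2 * (w + 1)) :
    HasMellin (fun v => (realP w v β : ℂ)) (-z)
      ((Real.pi : ℂ) ^ (β - 1 : ℂ) * ((-1) ^ w * (Real.pi / 2) / sin (Real.pi * z / 2) *
        ((Gamma (1 + β + z))⁻¹ * (z + β - 1 / 2)⁻¹ * (riemannZeta (2 * β + 2 * z))⁻¹))) := by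
  obtain ⟨g, -, hg, hk⟩ := realP_kernel hβ hw
  have h := hk.hasMellin z h1 h2
  have h' := hasMellin_const_smul h.1 ((Real.pi : ℂ) ^ (β - 1 : ℂ))
  rw [h.2] at h'
  have e : ∀ v ∈ Ioi (0 : ℝ), (realP w v β : ℂ) = (Real.pi : ℂ) ^ (β - 1 : ℂ) • (g v : ℂ) := by
    intro v hv
    rw [hg v (le_of_lt hv), ofReal_mul, ofReal_cpow Real.pi_nonneg]
    simp
  refine ⟨h'.1.congr_fun (fun v hv => ?_) measurableSet_Ioi, Eq.trans ?_ h'.2⟩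
  · simp only [e v hv]
  · refine setIntegral_congr_fun measurableSet_Ioi fun v hv => ?_
    simp only [e v hv]

end ZetaLaplace

/-! ### From Mellin to Laplace; zeros of n(s, β) and the strips between them. -/

/-- The substitution `v = π e^{-2y}` turns a Mellin transform into a two-sided Laplace transform. -/
theorem HasMellin.laplace {p : ℝ → ℂ} {s m : ℂ} (h : HasMellin p (-(s / 2)) m) :
    Integrable (fun y : ℝ => cexp (s * y) * p (Real.pi * Real.exp (-2 * y))) ∧
      ∫ y : ℝ, cexp (s * y) * p (Real.pi * Real.exp (-2 * y)) =
        (Real.pi : ℂ) ^ (s / 2) / 2 * m := by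
  set φ : ℝ → ℝ := fun y => Real.pi * Real.exp (-2 * y) with hφ
  have hpos : ∀ y, 0 < φ y := fun y => by positivity
  have hpi : (Real.pi : ℂ) ≠ 0 := ofReal_ne_zero.2 Real.pi_ne_zero
  have hd : ∀ y ∈ (univ : Set ℝ), HasDerivWithinAt φ (-2 * φ y) univ y := by
    intro y _
    have h1 : HasDerivAt (fun y : ℝ => -2 * y) (-2) y := by
      simpa using (hasDerivAt_id y).const_mul (-2)
    have h2 := (h1.exp.const_mul Real.pi).hasDerivWithinAt (s := univ)
    convert! h2 using 1
    simp only [hφ]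
    ring
  have hinj : InjOn φ univ := by
    intro x _ y _ hxy
    have := Real.exp_injective (mul_left_cancel₀ Real.pi_ne_zero hxy)
    linarith
  have himg : φ '' univ = Ioi 0 := by
    ext v
    refine ⟨?_, fun hv => ⟨-(Real.log (v / Real.pi)) / 2, trivial, ?_⟩⟩
    · rintro ⟨y, -, rfl⟩
      exact hpos y
    · have hv : 0 < v / Real.pi := div_pos hv Real.pi_pos
      simp only [hφ]
      rw [show -2 * (-(Real.log (v / Real.pi)) / 2) = Real.log (v / Real.pi) by ring,
        Real.exp_log hv]
      field_simp
  -- The Jacobian 2v cancels one power in v^{-s/2-1}, and v^{-s/2} = π^{-s/2} e^{sy}.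
  have hcongr : ∀ y : ℝ, |-2 * φ y| • ((φ y : ℂ) ^ (-(s / 2) - 1) • p (φ y)) =
      2 * (Real.pi : ℂ) ^ (-(s / 2)) * (cexp (s * y) * p (φ y)) := by
    intro y
    have h0 : (φ y : ℂ) ≠ 0 := ofReal_ne_zero.2 (hpos y).ne'
    have h1 : (φ y : ℂ) ^ (-(s / 2)) = (Real.pi : ℂ) ^ (-(s / 2)) * cexp (s * y) := by
      simp only [hφ]
      rw [ofReal_mul, mul_cpow_ofReal_nonneg Real.pi_nonneg (Real.exp_pos _).le, ofReal_exp,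
        ← Complex.ofReal_exp, Complex.cpow_def_of_ne_zero (ofReal_ne_zero.2 (Real.exp_ne_zero _)),
        ← Complex.ofReal_log (Real.exp_pos _).le, Real.log_exp]
      push_cast
      ring_nf
    rw [abs_mul, abs_of_pos (hpos y), abs_neg, abs_two, cpow_sub _ _ h0, cpow_one, h1,
      Complex.real_smul, smul_eq_mul]
    push_cast
    field_simp
  have hcne : 2 * (Real.pi : ℂ) ^ (-(s / 2)) ≠ 0 :=
    mul_ne_zero two_ne_zero (by simp [cpow_eq_zero_iff, hpi])
  have hi := integrableOn_image_iff_integrableOn_abs_deriv_smul MeasurableSet.univ hd hinj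
    (fun v => (v : ℂ) ^ (-(s / 2) - 1) • p v)
  have hv := integral_image_eq_integral_abs_deriv_smul MeasurableSet.univ hd hinj
    (fun v => (v : ℂ) ^ (-(s / 2) - 1) • p v)
  simp only [himg, hcongr, integrableOn_univ, Measure.restrict_univ, integral_const_mul] at hi hv
  refine ⟨(integrable_const_mul_iff (IsUnit.mk0 _ hcne) _).1 (hi.1 h.1), ?_⟩
  have hm : m = 2 * (Real.pi : ℂ) ^ (-(s / 2)) *
      ∫ y : ℝ, cexp (s * y) * p (φ y) := by rw [← hv, ← h.2]; rfl
  change ∫ y : ℝ, cexp (s * y) * p (φ y) = _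
  rw [hm, cpow_neg]
  have : (Real.pi : ℂ) ^ (s / 2) ≠ 0 := by simp [cpow_eq_zero_iff, hpi]
  field_simp

namespace ZetaLaplace

/-- Every factor of the product formula for ξ is nonzero to the right of Re s = 1, where ζ has an
Euler product. -/
theorem xi_ne_zero {s : ℂ} (hs : 1 < s.re) : xi s ≠ 0 := by
  have h1 : s ≠ 1 := by rintro rfl; simp at hs
  rw [xi_eq s h1 fun k hk => ?_]
  · have hG : Gamma (1 + s / 2) ≠ 0 := by
      refine Gamma_ne_zero_of_re_pos ?_
      rw [add_re, one_re, show s / 2 = s / (2 : ℝ) by push_cast; rfl, div_ofReal_re]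
      linarith
    have hpi : (Real.pi : ℂ) ^ (-s / 2) ≠ 0 := by
      simp [cpow_eq_zero_iff, Real.pi_ne_zero]
    have := riemannZeta_ne_zero_of_one_lt_re hs
    have := sub_ne_zero.2 h1
    simp [*]
  · have := congrArg re hk
    simp at this
    have : (0 : ℝ) ≤ k := k.cast_nonneg
    linarith

theorem xi_one_sub (s : ℂ) : xi (1 - s) = xi s := by
  rw [xi, xi, completedRiemannZeta₀_one_sub]
  ring

theorem differentiable_n (β : ℂ) : Differentiable ℂ fun s => n s β := by
  unfold n
  have := differentiable_xi
  fun_prop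

theorem sin_eq_zero_iff_eq_four_mul {s : ℂ} :
    sin (Real.pi * s / 4) = 0 ↔ ∃ m : ℤ, s = 4 * m := by
  have hpi : (Real.pi : ℂ) ≠ 0 := ofReal_ne_zero.2 Real.pi_ne_zero
  rw [Complex.sin_eq_zero_iff]
  refine exists_congr fun m => ⟨fun h => ?_, fun h => ?_⟩
  · refine mul_left_cancel₀ hpi ?_
    linear_combination 4 * h
  · rw [h]
    ring

theorem n_eq_zero_iff {s β : ℂ} (h : xi (2 * β + s) ≠ 0) : n s β = 0 ↔ ∃ m : ℤ, s = 4 * m := by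
  rw [← sin_eq_zero_iff_eq_four_mul, n, mul_eq_zero]
  simp [h]

/-- At a zero of the sine the product rule leaves (π/4) cos(πs/4) · 2ξ(2β+s), and sine and cosine
have no common zero. -/
theorem deriv_n_ne_zero {s β : ℂ} (h : xi (2 * β + s) ≠ 0) (h0 : n s β = 0) :
    deriv (fun s => n s β) s ≠ 0 := by
  have hs : sin (Real.pi * s / 4) = 0 := by
    rw [sin_eq_zero_iff_eq_four_mul]
    exact (n_eq_zero_iff h).1 h0
  have hc : cos (Real.pi * s / 4) ≠ 0 := by
    intro hc
    have := Complex.sin_sq_add_cos_sq (Real.pi * s / 4)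
    simp [hs, hc] at this
  have h1 : HasDerivAt (fun s : ℂ => (Real.pi : ℂ) * s / 4) (Real.pi / 4) s := by
    simpa using ((hasDerivAt_id s).const_mul (Real.pi : ℂ)).div_const 4
  have h2 : DifferentiableAt ℂ (fun s => 2 * xi (2 * β + s)) s := by
    have := differentiable_xi
    fun_prop
  have h3 := h1.csin.mul h2.hasDerivAt
  have h4 : deriv (fun s => n s β) s = _ := h3.deriv
  rw [h4, hs]
  have hpi : (Real.pi : ℂ) ≠ 0 := ofReal_ne_zero.2 Real.pi_ne_zero
  simp [hc, h, hpi]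

theorem xi_ne_zero_of_one_lt {β : ℝ} (hβ : 0 ≤ β) {s : ℂ} (hs : 1 < s.re) :
    xi (2 * β + s) ≠ 0 := by
  refine xi_ne_zero ?_
  simp
  linarith

theorem n_ne_zero_of_mem_strip {s β : ℂ} {m : ℤ} (h : xi (2 * β + s) ≠ 0)
    (hs : s ∈ V (4 * m) (4 * (m + 1))) : n s β ≠ 0 := by
  rw [Ne, n_eq_zero_iff h]
  rintro ⟨k, rfl⟩
  have h1 := hs.1
  have h2 := hs.2
  simp only [mul_re, intCast_re, intCast_im, mul_zero, sub_zero] at h1 h2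
  norm_num at h1 h2
  have h1' : m < k := by exact_mod_cast h1
  have h2' : k < m + 1 := by exact_mod_cast h2
  omega

theorem differentiableOn_f {β : ℂ} {m : ℤ}
    (h : ∀ s ∈ V (4 * m) (4 * (m + 1)), xi (2 * β + s) ≠ 0) :
    DifferentiableOn ℂ (fun s => f s β) (V (4 * m) (4 * (m + 1))) := by
  refine DifferentiableOn.div (differentiableOn_const 1) (differentiable_n β).differentiableOn ?_
  exact fun s hs => n_ne_zero_of_mem_strip (h s hs) hs

section

variable {β : ℝ}

/-- With z = s/2 and u = 2β + s, the factor z + β - 1/2 is (u-1)/2 and Γ(1+β+z) is Γ(1+u/2), so the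
Mellin value is the reciprocal of sin(πs/4) times the product formula for 2ξ(u). -/
theorem laplace_f (hβ : 0 ≤ β) {w : ℕ} (hw : 1 ≤ w) {s : ℂ} (hs : s ∈ V (4 * w) (4 * (w + 1))) :
    Integrable (fun y : ℝ => cexp (s * y) * P w ((Real.pi * Real.exp (-2 * y) : ℝ) : ℂ) β) ∧
      (-1) ^ w * f s β =
        ∫ y : ℝ, cexp (s * y) * P w ((Real.pi * Real.exp (-2 * y) : ℝ) : ℂ) β := by
  have hw' : (1 : ℝ) ≤ w := by exact_mod_cast hw
  have hre : (s / 2).re = s.re / 2 := by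
    rw [show s / 2 = s / (2 : ℝ) by push_cast; rfl, div_ofReal_re]
  have h := (hasMellin_realP hβ hw (z := s / 2) (by rw [hre]; linarith [hs.1])
    (by rw [hre]; linarith [hs.2])).laplace
  simp only [P_ofReal hβ]
  refine ⟨h.1, ?_⟩
  rw [h.2, f, n]
  have h4 : 4 < s.re := by linarith [hs.1]
  have hu : 1 < (2 * β + s : ℂ).re := by
    simp
    linarith
  have hxi := xi_ne_zero hu
  have hne1 : (2 * β + s : ℂ) ≠ 1 := by intro h; rw [h] at hu; simp at hu
  have hx := xi_eq (2 * β + s) hne1 (fun k hk => by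
    rw [hk] at hu
    simp at hu
    have : (0 : ℝ) ≤ k := k.cast_nonneg
    linarith)
  have hpi : (Real.pi : ℂ) ≠ 0 := ofReal_ne_zero.2 Real.pi_ne_zero
  have hp : (Real.pi : ℂ) ^ (-(2 * β + s) / 2) =
      ((Real.pi : ℂ) ^ (s / 2) * (Real.pi : ℂ) ^ (β - 1 : ℂ) * Real.pi)⁻¹ := by
    rw [← cpow_add _ _ hpi]
    nth_rewrite 3 [← cpow_one (Real.pi : ℂ)]
    rw [← cpow_add _ _ hpi, ← cpow_neg]
    congr 1
    ring
  rw [hx, hp, show 2 * (β : ℂ) + 2 * (s / 2) = 2 * β + s by ring,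
    show s / 2 + (β : ℂ) - 1 / 2 = (2 * β + s - 1) / 2 by ring,
    show (1 : ℂ) + β + s / 2 = 1 + (2 * β + s) / 2 by ring,
    show (Real.pi : ℂ) * (s / 2) / 2 = Real.pi * s / 4 by ring]
  simp only [div_eq_mul_inv, mul_inv, inv_inv, one_mul]
  ring

/-- A positive density with the right two-sided Laplace transform exhibits an analytic
characteristic function. -/
theorem isAnalyticCharFun_of_density {j : ℂ → ℂ} {a b : ℝ} {p : ℝ → ℝ} (hp : Measurable p)
    (hpos : ∀ y, 0 < p y) (hj : DifferentiableOn ℂ j (V a b))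
    (h : ∀ s ∈ V a b, Integrable (fun y : ℝ => cexp (s * y) * (p y : ℂ)) ∧
      j s = ∫ y : ℝ, cexp (s * y) * (p y : ℂ)) : IsAnalyticCharFun j a b := by
  have hm : Measurable fun y => ENNReal.ofReal (p y) := hp.ennreal_ofReal
  have hlt : ∀ᵐ y : ℝ, ENNReal.ofReal (p y) < ⊤ := .of_forall fun y => ENNReal.ofReal_lt_top
  have hc : ∀ (s : ℂ) (y : ℝ), (ENNReal.ofReal (p y)).toReal • cexp (s * y) =
      cexp (s * y) * (p y : ℂ) := by
    intro s y
    rw [ENNReal.toReal_ofReal (hpos y).le, Complex.real_smul, mul_comm]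
  refine ⟨hj, volume.withDensity fun y => ENNReal.ofReal (p y), ?_, fun s hs => ⟨?_, ?_⟩⟩
  · intro h0
    rw [withDensity_eq_zero_iff hm.aemeasurable] at h0
    obtain ⟨y, hy⟩ := h0.exists
    exact absurd (ENNReal.ofReal_eq_zero.1 hy) (not_le.2 (hpos y))
  · rw [integrable_withDensity_iff_integrable_smul' hm hlt]
    simp only [hc]
    exact (h s hs).1
  · rw [integral_withDensity_eq_integral_toReal_smul hm hlt]
    simp only [hc]
    exact (h s hs).2

theorem measurable_realP_comp (hβ : 0 ≤ β) {w : ℕ} (hw : 1 ≤ w) {φ : ℝ → ℝ} (hφ : Measurable φ)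
    (h0 : ∀ y, 0 ≤ φ y) : Measurable fun y => realP w (φ y) β := by
  obtain ⟨g, -, hg, hk⟩ := realP_kernel hβ hw
  have := hk.measurable
  simp only [fun y => hg (φ y) (h0 y)]
  fun_prop

theorem isAnalyticCharFun_or_neg {h : ℂ → ℂ} {a b : ℝ} (k : ℕ)
    (hk : IsAnalyticCharFun (fun z => (-1) ^ k * h z) a b) :
    IsAnalyticCharFun h a b ∨ IsAnalyticCharFun (fun z => -h z) a b := by
  rcases neg_one_pow_eq_or ℂ k with e | e
  · exact .inl (by simpa [e] using hk)
  · exact .inr (by simpa [e] using hk)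

theorem isAnalyticCharFun_f (hβ : 0 ≤ β) {w : ℕ} (hw : 1 ≤ w) :
    IsAnalyticCharFun (fun z => (-1) ^ w * f z β) (4 * w) (4 * (w + 1)) := by
  have hw' : (1 : ℝ) ≤ w := by exact_mod_cast hw
  refine isAnalyticCharFun_of_density (p := fun y => realP w (Real.pi * Real.exp (-2 * y)) β)
    (measurable_realP_comp hβ hw (by fun_prop) fun y => by positivity)
    (fun y => realP_pos hβ hw (by positivity)) ?_ fun s hs => ?_
  · have := differentiableOn_f (β := β) (m := w) fun s hs =>
      xi_ne_zero_of_one_lt hβ (by have := hs.1; push_cast at this; linarith)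
    exact (by simpa using this : DifferentiableOn ℂ (fun s => f s β) _).const_mul _
  · simpa only [P_ofReal hβ] using laplace_f hβ hw hs

/-- The zeros and strips of `n(s, β)` in a domain on which `ξ(2β + s)` has no zero. -/
theorem isMeromorphicCharFunOn_f {D : Set ℂ} (hxi : ∀ s ∈ D, xi (2 * β + s) ≠ 0)
    (h0 : (0 : ℂ) ∉ D)
    (habove : ¬ BddAbove {x : ℝ | (x : ℂ) ∈ D} → ∀ N : ℕ, ∃ m : ℤ, N ≤ m ∧ (4 * m : ℂ) ∈ D)
    (hbelow : ¬ BddBelow {x : ℝ | (x : ℂ) ∈ D} → ∀ N : ℕ, ∃ m : ℤ, m ≤ -N ∧ (4 * m : ℂ) ∈ D)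
    (hstrip : ∀ m : ℤ, (4 * m : ℂ) ∈ D → (4 * (m + 1) : ℂ) ∈ D →
      ∃ k : ℕ, IsAnalyticCharFun (fun z => (-1) ^ k * f z β) (4 * m) (4 * (m + 1))) :
    IsMeromorphicCharFunOn (fun s => f s β) D := by
  have hz : ∀ m : ℤ, (4 * m : ℂ) ∈ D → n (4 * m) β = 0 := fun m hm =>
    (n_eq_zero_iff (hxi _ hm)).2 ⟨m, rfl⟩
  refine ⟨fun s => n s β, differentiable_n β, fun z => rfl, fun z hzD hz0 => ?_,
    fun h => absurd h h0, fun h => ?_, fun h => ?_,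
    fun x hx hx0 => deriv_n_ne_zero (hxi _ hx) hx0, ?_⟩
  · obtain ⟨m, rfl⟩ := (n_eq_zero_iff (hxi _ hzD)).1 hz0
    left
    simp
  · rintro ⟨B, hB⟩
    obtain ⟨N, hN⟩ := exists_nat_gt (|B|)
    obtain ⟨m, hm, hmD⟩ := habove h N
    have hm' : (N : ℝ) ≤ m := by exact_mod_cast hm
    have := hB (show (4 * m : ℝ) ∈ _ from ⟨by push_cast; exact hmD, by push_cast; exact hz m hmD⟩)
    have := le_abs_self B
    have := abs_nonneg B
    linarith
  · rintro ⟨B, hB⟩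
    obtain ⟨N, hN⟩ := exists_nat_gt (|B|)
    obtain ⟨m, hm, hmD⟩ := hbelow h N
    have hm' : (m : ℝ) ≤ -N := by exact_mod_cast hm
    have := hB (show (4 * m : ℝ) ∈ _ from ⟨by push_cast; exact hmD, by push_cast; exact hz m hmD⟩)
    have := neg_abs_le B
    have := abs_nonneg B
    linarith
  · intro a b hab ha hb hV ha0 hb0 hne
    obtain ⟨k, hk⟩ := (n_eq_zero_iff (hxi _ ha)).1 ha0
    obtain ⟨l, hl⟩ := (n_eq_zero_iff (hxi _ hb)).1 hb0
    have hk' : a = 4 * k := by exact_mod_cast hk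
    have hl' : b = 4 * l := by exact_mod_cast hl
    subst hk' hl'
    have hkl : k < l := by
      have : (k : ℝ) < l := by linarith
      exact_mod_cast this
    -- Otherwise 4(k+1) would be a further zero between a and b; it lies in D because the whole
    -- strip does.
    have hlk : l = k + 1 := by
      by_contra hne'
      have h2 : k + 1 < l := by omega
      have h2' : (k : ℝ) + 1 < l := by exact_mod_cast h2
      have hmem : (4 * ((k + 1 : ℤ) : ℂ)) ∈ D := by
        refine hV ⟨?_, ?_⟩
        · simp
        · simp
          linarith
      refine hne (4 * ((k + 1 : ℤ) : ℝ)) (by push_cast; linarith) (by push_cast; linarith) ?_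
      have := hz _ hmem
      push_cast at this ⊢
      exact this
    subst hlk
    push_cast at ha hb ⊢
    obtain ⟨j, hj⟩ := hstrip k ha hb
    exact isAnalyticCharFun_or_neg j hj

theorem isMeromorphicCharFunOn_re (hβ : 0 ≤ β) :
    IsMeromorphicCharFunOn (fun s => f s β) {s | 4 ≤ s.re} := by
  refine isMeromorphicCharFunOn_f (fun s hs => xi_ne_zero_of_one_lt hβ ?_) (by simp) ?_ ?_ ?_
  · have : 4 ≤ s.re := hs
    linarith
  · intro _ N
    refine ⟨N + 1, by omega, ?_⟩
    simp
  · intro h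
    refine absurd ⟨4, ?_⟩ h
    intro x hx
    simpa using hx
  · intro m hm _
    have hm1 : 1 ≤ m := by
      have : (1 : ℝ) ≤ m := by
        have h4 : 4 ≤ (4 * m : ℂ).re := hm
        simp at h4
        linarith
      exact_mod_cast this
    lift m to ℕ using by omega
    exact ⟨m, by simpa using isAnalyticCharFun_f hβ (w := m) (by omega)⟩

end

/-! ### Reflection for β = 1/4. -/

section Quarter

/-- At β = 1/4 the argument of ξ is 1/2 + s, so the functional equation makes that factor even, and
the sine is odd. -/
theorem n_neg (s : ℂ) : n (-s) (1 / 4 : ℝ) = -n s (1 / 4 : ℝ) := by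
  rw [n, n, show 2 * ((1 / 4 : ℝ) : ℂ) + -s = 1 - (2 * ((1 / 4 : ℝ) : ℂ) + s) by push_cast; ring,
    xi_one_sub, show (Real.pi : ℂ) * -s / 4 = -(Real.pi * s / 4) by ring, Complex.sin_neg]
  ring

theorem f_neg (s : ℂ) : f (-s) (1 / 4 : ℝ) = -f s (1 / 4 : ℝ) := by
  rw [f, f, n_neg, div_neg]

/-- The substitution y ↦ -y reflects the formula for -s, and the oddness of f supplies the extra
sign in (-1)^{w+1}. -/
theorem laplace_f_neg {w : ℕ} (hw : 1 ≤ w) {s : ℂ} (hs : s ∈ V (-4 * (w + 1)) (-4 * w)) :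
    Integrable (fun y : ℝ => cexp (s * y) *
      P w ((Real.pi * Real.exp (2 * y) : ℝ) : ℂ) (1 / 4 : ℝ)) ∧
      (-1) ^ (w + 1) * f s (1 / 4 : ℝ) = ∫ y : ℝ, cexp (s * y) *
        P w ((Real.pi * Real.exp (2 * y) : ℝ) : ℂ) (1 / 4 : ℝ) := by
  have hs' : -s ∈ V (4 * w) (4 * (w + 1)) :=
    ⟨by rw [neg_re]; linarith [hs.2], by rw [neg_re]; linarith [hs.1]⟩
  have h := laplace_f (β := 1 / 4) (by norm_num) hw hs'
  have e : ∀ y : ℝ, cexp (-s * (-y : ℝ)) *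
      P w ((Real.pi * Real.exp (-2 * -y) : ℝ) : ℂ) (1 / 4 : ℝ) =
      cexp (s * y) * P w ((Real.pi * Real.exp (2 * y) : ℝ) : ℂ) (1 / 4 : ℝ) := by
    intro y
    congr 2
    · push_cast
      ring
    · rw [neg_mul_neg]
  refine ⟨?_, ?_⟩
  · have h1 := h.1.comp_neg
    simp only [e] at h1
    exact h1
  · have h2 := integral_neg_eq_self (fun y : ℝ => cexp (-s * y) *
      P w ((Real.pi * Real.exp (-2 * y) : ℝ) : ℂ) (1 / 4 : ℝ)) volume
    simp only [e] at h2
    rw [h2, ← h.2, f_neg, pow_succ]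
    ring

theorem xi_ne_zero_of_le_abs_re {s : ℂ} (hs : 4 ≤ |s.re|) : xi (2 * (1 / 4 : ℝ) + s) ≠ 0 := by
  rcases le_abs.1 hs with h | h
  · exact xi_ne_zero_of_one_lt (by norm_num) (by linarith)
  · rw [← xi_one_sub, show 1 - (2 * ((1 / 4 : ℝ) : ℂ) + s) = 2 * ((1 / 4 : ℝ) : ℂ) + -s by
      push_cast; ring]
    exact xi_ne_zero_of_one_lt (by norm_num) (by rw [neg_re]; linarith)

theorem isAnalyticCharFun_f_neg {w : ℕ} (hw : 1 ≤ w) :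
    IsAnalyticCharFun (fun z => (-1) ^ (w + 1) * f z (1 / 4 : ℝ)) (-4 * (w + 1)) (-4 * w) := by
  have hw' : (1 : ℝ) ≤ w := by exact_mod_cast hw
  have hβ : (0 : ℝ) ≤ 1 / 4 := by norm_num
  refine isAnalyticCharFun_of_density
    (p := fun y => realP w (Real.pi * Real.exp (2 * y)) (1 / 4))
    (measurable_realP_comp hβ hw (by fun_prop) fun y => by positivity)
    (fun y => realP_pos hβ hw (by positivity)) ?_ fun s hs => ?_
  · have := differentiableOn_f (β := (1 / 4 : ℝ)) (m := -(w + 1)) fun s hs =>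
      xi_ne_zero_of_le_abs_re (le_abs.2 (.inr (by
        have := hs.2
        push_cast at this
        linarith)))
    refine DifferentiableOn.const_mul ?_ _
    convert! this using 2 <;> push_cast <;> ring
  · simpa only [P_ofReal hβ] using laplace_f_neg hw hs

theorem isMeromorphicCharFunOn_abs_re :
    IsMeromorphicCharFunOn (fun s => f s (1 / 4 : ℝ)) {s | 4 ≤ |s.re|} := by
  refine isMeromorphicCharFunOn_f (fun s hs => xi_ne_zero_of_le_abs_re hs) (by simp) ?_ ?_ ?_
  · intro _ N
    refine ⟨N + 1, by omega, mem_ofPred.2 (le_abs.2 (.inl ?_))⟩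
    simp
  · intro _ N
    refine ⟨-(N + 1), by omega, mem_ofPred.2 (le_abs.2 (.inr ?_))⟩
    simp
    linarith [(N.cast_nonneg : (0 : ℝ) ≤ N)]
  · intro m hm hm'
    have h1 : 4 ≤ |(4 * m : ℂ).re| := hm
    have h2 : 4 ≤ |(4 * (m + 1) : ℂ).re| := hm'
    -- The point 0 is outside the domain, so neither strip adjacent to the imaginary axis, m = 0 or
    -- m = -1, has to be treated.
    have hm0 : m ≠ 0 := by
      rintro rfl
      norm_num at h1
    have hm1 : m ≠ -1 := by
      rintro rfl
      norm_num at h2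
    rcases lt_or_gt_of_ne hm0 with h | h
    · obtain ⟨w, hw⟩ : ∃ w : ℕ, m = -(w + 1) := ⟨(-(m + 1)).toNat, by omega⟩
      subst hw
      refine ⟨w + 1, ?_⟩
      convert! isAnalyticCharFun_f_neg (w := w) (by omega) using 1 <;> push_cast <;> ring
    · lift m to ℕ using by omega
      exact ⟨m, by simpa using isAnalyticCharFun_f (β := 1 / 4) (by norm_num) (w := m) (by omega)⟩

end Quarter

end ZetaLaplace

theorem lemma6p2 (β : ℝ) (hβ : 0 ≤ β) :
    -- the series defining `P_{4w}(z, β)` converges absolutely, `P_{4w}(v, β)` is real for real `v`,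
    -- vanishes at `0`, and is strictly increasing on `[0, π]`
    (∀ w : ℕ,
      (∀ z : ℂ, Summable fun j : ℕ => ‖ZetaLaplace.PTerm z β (w + 1 + j)‖) ∧
      (∀ v : ℝ, (ZetaLaplace.P w v β).im = 0) ∧
      ZetaLaplace.P w 0 β = 0 ∧
      StrictMonoOn (fun v : ℝ => (ZetaLaplace.P w v β).re) (Set.Icc 0 Real.pi)) ∧
    -- for `w ≥ 1`: positivity
    (∀ w : ℕ, 1 ≤ w → ∀ v : ℝ, 0 < v → 0 < (ZetaLaplace.P w v β).re) ∧
    -- for `w ≥ 1`: `(-1)^w f(s, β)` is analytic on `V_{4w}` and is there the absolutely convergent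
    -- Laplace transform of `P_{4w}(π e^{-2y}, β)`, which is positive
    (∀ w : ℕ, 1 ≤ w →
      DifferentiableOn ℂ (fun s => ZetaLaplace.f s β) (ZetaLaplace.V (4 * w) (4 * (w + 1))) ∧
      (∀ y : ℝ, 0 < (ZetaLaplace.P w ((Real.pi * Real.exp (-2 * y) : ℝ) : ℂ) β).re) ∧
      ∀ s ∈ ZetaLaplace.V (4 * w) (4 * (w + 1)),
        MeasureTheory.Integrable (fun y : ℝ =>
          Complex.exp (s * y) * ZetaLaplace.P w ((Real.pi * Real.exp (-2 * y) : ℝ) : ℂ) β) ∧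
        (-1) ^ w * ZetaLaplace.f s β = ∫ y : ℝ,
          Complex.exp (s * y) * ZetaLaplace.P w ((Real.pi * Real.exp (-2 * y) : ℝ) : ℂ) β) ∧
    -- `f(s, β)` is a meromorphic characteristic function on `Re s ≥ 4`
    ZetaLaplace.IsMeromorphicCharFunOn (fun s => ZetaLaplace.f s β) {s | 4 ≤ s.re} ∧
    -- for `β = 1/4`: on the reflected strip `V_{4w'}`, `w' = -(w + 1)`, `w ≥ 1`, the function
    -- `(-1)^{w'} f(s)` has the positive Laplace density `P_{4w}(π e^{2y})`, and `f(s)` is a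
    -- meromorphic characteristic function on `|Re s| ≥ 4`
    (β = 1 / 4 →
      (∀ w : ℕ, 1 ≤ w → ∀ s ∈ ZetaLaplace.V (-4 * (w + 1)) (-4 * w),
        MeasureTheory.Integrable (fun y : ℝ =>
          Complex.exp (s * y) * ZetaLaplace.P w ((Real.pi * Real.exp (2 * y) : ℝ) : ℂ) β) ∧
        (-1) ^ (w + 1) * ZetaLaplace.f s β = ∫ y : ℝ,
          Complex.exp (s * y) * ZetaLaplace.P w ((Real.pi * Real.exp (2 * y) : ℝ) : ℂ) β) ∧
      ZetaLaplace.IsMeromorphicCharFunOn (fun s => ZetaLaplace.f s β) {s | 4 ≤ |s.re|}) := by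
  refine ⟨fun w => ⟨ZetaLaplace.summable_norm_PTerm hβ w, fun v => ?_, ?_, ?_⟩,
    fun w hw v hv => ?_, fun w hw => ⟨?_, fun y => ?_, fun s hs => ZetaLaplace.laplace_f hβ hw hs⟩,
    ZetaLaplace.isMeromorphicCharFunOn_re hβ, ?_⟩
  · rw [ZetaLaplace.P_ofReal hβ, ofReal_im]
  · have := ZetaLaplace.P_ofReal hβ w 0
    rwa [ZetaLaplace.realP_zero, ofReal_zero] at this
  · simpa only [ZetaLaplace.P_ofReal hβ, ofReal_re] using ZetaLaplace.strictMonoOn_realP hβ w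
  · rw [ZetaLaplace.P_ofReal hβ, ofReal_re]
    exact ZetaLaplace.realP_pos hβ hw hv
  · have hw' : (1 : ℝ) ≤ w := by exact_mod_cast hw
    have := ZetaLaplace.differentiableOn_f (β := β) (m := w) fun s hs =>
      ZetaLaplace.xi_ne_zero_of_one_lt hβ (by have := hs.1; push_cast at this; linarith)
    simpa using this
  · rw [ZetaLaplace.P_ofReal hβ, ofReal_re]
    exact ZetaLaplace.realP_pos hβ hw (by positivity)
  · rintro rfl
    exact ⟨fun w hw s hs => ZetaLaplace.laplace_f_neg hw hs,
      ZetaLaplace.isMeromorphicCharFunOn_abs_re⟩
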